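/- Let $\mathbb N=\{1,2,\dots\}$. For sets $A,B\subset\mathbb N$ write $A<B$ if $a<b$ for all $a\in A$, $b\in B$, and for $n\in\mathbb N$ write $n\le A$ if $n\le a$ for all $a\in A$, and $n<A$ if $n<a$ for all $a\in A$. The Schreier families $\mathcal S_\xi$, $\xi<\omega_1$, of finite subsets of $\mathbb N$ are defined by transfinite induction: $\mathcal S_0=\{\emptyset\}\cup\{\{n\}:n\in\mathbb N\}$, $$\mathcal S_{\gamma+1}=\Big\{\bigcup_{i=1}^nE_i:\ n\in\mathbb N,\ n\le E_1<\dots<E_n,\ E_i\in\mathcal S_\gamma\Big\},$$ and for a limit ordinal $\xi$, $\mathcal S_\xi=\{E:\exists n\le E \text{ with } E\in\mathcal S_{\alpha(\xi,n)}\}$, where $(\alpha(\xi,n))_{n\ge1}$ is a fixed sequence of successor ordinals below $\xi$ increasing to $\xi$ with $\alpha(\xi,1)=1$ and such that $A\cup B\in\mathcal S_{\alpha(\xi,n+1)}$ whenever $n\in\mathbb N$, $A,B\in\mathcal S_{\alpha(\xi,n)}$ and $1<A<B$. For $\xi<\omega_1$ and $0<\theta<1$, a sequence $(E_i)_{i=1}^k$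 of nonempty subsets of $\mathbb N$ is called $\mathcal S_\xi$-admissible if $E_1<\dots<E_k$ and $\{\min E_i:1\le i\le k\}\in\mathcal S_\xi$, and $\mathcal S_\xi$-allowable if the $E_i$ are pairwise disjoint and $\{\min E_i:1\le i\le k\}\in\mathcal S_\xi$. The Tsirelson space $T[\mathcal S_\xi,\theta]$ is the completion of the space $c_{00}$ of finitely supported real sequences under the norm given by the implicit equation $$\|x\|=\max\Big\{\|x\|_\infty,\ \theta\sup\Big\{\sum_{i=1}^k\|E_ix\|:\ k\in\mathbb N,\ (E_i)_{i=1}^k \text{ finite sets forming an } \mathcal S_\xi\text{-admissible sequence}\Big\}\Big\},$$ where $E x$ is the restriction of $x$ to $E$. The support of $y\in T[\mathcal S_\xi,\theta]$ is the set of its nonzero coordinates (with respect to the unit vector basis). Then for every such choice of the sequences $(\alpha(\xi,n))_n$, every $\xi<\omega_1$, every $0<\theta<1$, every $k$, and all vectors $y_1,\dots,y_k\in T[\mathcal S_\xi,\theta]$ of norm one whose supports form an $\mathcal S_\xi$-allowable sequence, $(y_j)_{j=1}^k$ is $\frac\theta3$-equivalent to the unit vector basis of $\ell_1^k$, that is,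 for all real $a_1,\dots,a_k$, $$\frac\theta3\sum_{j=1}^k|a_j|\ \le\ \Big\|\sum_{j=1}^ka_jy_j\Big\|\ \le\ \sum_{j=1}^k|a_j|.$$ -/

import Mathlib

open scoped ENNReal Ordinal

/-- `A < B` for finite sets of positive integers: every element of `A` is smaller than every
element of `B` (in particular `A < ∅` and `∅ < A`). -/
def SetLT (A B : Set ℕ+) : Prop := ∀ a ∈ A, ∀ b ∈ B, a < b

/-- The Schreier family of order `ξ`, with respect to a choice `α` of approximating sequences,
as the predicate `SchreierMem α ξ E` on finite sets `E` of positive integers.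
Order `0`: the empty set and the singletons. Order `γ + 1`: the unions `E₁ ∪ ⋯ ∪ Eₙ` with
`n ≤ E₁ < ⋯ < Eₙ` of order `γ`. Limit order `ξ`: the sets `E` of order `α ξ n` with `n ≤ E`. -/
inductive SchreierMem (α : Ordinal.{0} → ℕ+ → Ordinal.{0}) : Ordinal.{0} → Finset ℕ+ → Prop
  | empty : SchreierMem α 0 ∅
  | singleton (n : ℕ+) : SchreierMem α 0 {n}
  | succ (γ : Ordinal.{0}) (n : ℕ+) (E : Fin n → Finset ℕ+)
      (mem : ∀ i, SchreierMem α γ (E i))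
      (le : ∀ i, ∀ m ∈ E i, n ≤ m)
      (lt : ∀ i j, i < j → SetLT (E i) (E j)) :
      SchreierMem α (Order.succ γ) (Finset.univ.biUnion E)
  | limit (ξ : Ordinal.{0}) (hξ : Order.IsSuccLimit ξ) (n : ℕ+) (E : Finset ℕ+)
      (mem : SchreierMem α (α ξ n) E)
      (le : ∀ m ∈ E, n ≤ m) :
      SchreierMem α ξ E

/-- The Schreier family `𝓢_ξ` of order `ξ`. -/
def schreier (α : Ordinal.{0} → ℕ+ → Ordinal.{0}) (ξ : Ordinal.{0}) : Set (Finset ℕ+) :=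
  {E | SchreierMem α ξ E}

/-- `α` is an admissible choice of approximating sequences: for every countable limit ordinal `ξ`,
`(α ξ n)ₙ` is a sequence of successor ordinals below `ξ` that increases to `ξ` and starts with `1`,
and `A ∪ B ∈ 𝓢_{α ξ (n + 1)}` whenever `A, B ∈ 𝓢_{α ξ n}` and `1 < A < B`. -/
structure IsApproximatingSystem (α : Ordinal.{0} → ℕ+ → Ordinal.{0}) : Prop where
  exists_succ : ∀ ξ < ω₁, Order.IsSuccLimit ξ → ∀ n, ∃ β, α ξ n = Order.succ β
  lt : ∀ ξ < ω₁, Order.IsSuccLimit ξ → ∀ n, α ξ n < ξ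
  mono : ∀ ξ < ω₁, Order.IsSuccLimit ξ → Monotone (α ξ)
  cofinal : ∀ ξ < ω₁, Order.IsSuccLimit ξ → ∀ β < ξ, ∃ n, β < α ξ n
  one : ∀ ξ < ω₁, Order.IsSuccLimit ξ → α ξ 1 = 1
  union_mem : ∀ ξ < ω₁, Order.IsSuccLimit ξ → ∀ (n : ℕ+) (A B : Finset ℕ+),
    A ∈ schreier α (α ξ n) → B ∈ schreier α (α ξ n) → SetLT {1} A → SetLT A B →
    A ∪ B ∈ schreier α (α ξ (n + 1))

/-- The sequence of (nonempty) sets `E₁, …, E_k` is `𝓕`-admissible: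
`E₁ < ⋯ < E_k` and `{min E₁, …, min E_k} ∈ 𝓕`. -/
def IsAdmissible (𝓕 : Set (Finset ℕ+)) {k : ℕ} (E : Fin k → Set ℕ+) : Prop :=
  (∀ i j, i < j → SetLT (E i) (E j)) ∧
    ∃ m : Fin k → ℕ+, (∀ i, IsLeast (E i) (m i)) ∧ Finset.univ.image m ∈ 𝓕

/-- The sequence of (nonempty) sets `E₁, …, E_k` is `𝓕`-allowable:
the sets are pairwise disjoint and `{min E₁, …, min E_k} ∈ 𝓕`. -/
def IsAllowable (𝓕 : Set (Finset ℕ+)) {k : ℕ} (E : Fin k → Set ℕ+) : Prop :=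
  (∀ i j, i ≠ j → Disjoint (E i) (E j)) ∧
    ∃ m : Fin k → ℕ+, (∀ i, IsLeast (E i) (m i)) ∧ Finset.univ.image m ∈ 𝓕

/-- The projection `E x` of a finitely supported sequence `x` onto a finite set `E`. -/
noncomputable def proj (E : Finset ℕ+) (x : ℕ+ →₀ ℝ) : ℕ+ →₀ ℝ := x.filter (· ∈ E)

/-- The iterates, starting at `‖·‖_∞`, of the map
`N ↦ max (‖x‖_∞, θ sup {∑ N (Eᵢ x) : (Eᵢ) is 𝓕-admissible})`. -/
noncomputable def tsirelsonIter (𝓕 : Set (Finset ℕ+)) (θ : ℝ) : ℕ → (ℕ+ →₀ ℝ) → ℝ≥0∞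
  | 0, x => ⨆ n, ‖x n‖ₑ
  | s + 1, x => max (⨆ n, ‖x n‖ₑ) (ENNReal.ofReal θ *
      ⨆ (k : ℕ) (E : Fin k → Finset ℕ+) (_ : IsAdmissible 𝓕 fun i => (E i : Set ℕ+)),
        ∑ i, tsirelsonIter 𝓕 θ s (proj (E i) x))

/-- The Tsirelson norm of a finitely supported sequence: the supremum of the iterates. It is the
unique solution of the implicit equation, see `tsirelsonNorm_eq` and `tsirelsonNorm_unique`. -/
noncomputable def tsirelsonNorm (𝓕 : Set (Finset ℕ+)) (θ : ℝ) (x : ℕ+ →₀ ℝ) : ℝ :=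
  (⨆ s, tsirelsonIter 𝓕 θ s x).toReal

/-- The set of all sums `∑ N (Eᵢ x)` over the `𝓕`-admissible sequences `(Eᵢ)`. -/
def admissibleSums (𝓕 : Set (Finset ℕ+)) (N : (ℕ+ →₀ ℝ) → ℝ) (x : ℕ+ →₀ ℝ) : Set ℝ :=
  {r | ∃ (k : ℕ) (E : Fin k → Finset ℕ+), IsAdmissible 𝓕 (fun i => (E i : Set ℕ+)) ∧
    r = ∑ i, N (proj (E i) x)}

section TsirelsonNorm

variable {𝓕 : Set (Finset ℕ+)} {θ : ℝ}

theorem le_iSup_isAdmissible (g : (k : ℕ) → (Fin k → Finset ℕ+) → ℝ≥0∞) {k : ℕ}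
    {E : Fin k → Finset ℕ+} (hE : IsAdmissible 𝓕 fun i => (E i : Set ℕ+)) :
    g k E ≤ ⨆ (k : ℕ) (E : Fin k → Finset ℕ+) (_ : IsAdmissible 𝓕 fun i => (E i : Set ℕ+)),
      g k E :=
  (le_iSup (fun _ : IsAdmissible 𝓕 fun i => (E i : Set ℕ+) => g k E) hE).trans
    ((le_iSup (fun E : Fin k → Finset ℕ+ =>
      ⨆ _ : IsAdmissible 𝓕 fun i => (E i : Set ℕ+), g k E) E).trans
    (le_iSup (fun k : ℕ => ⨆ (E : Fin k → Finset ℕ+)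
      (_ : IsAdmissible 𝓕 fun i => (E i : Set ℕ+)), g k E) k))

theorem enorm_apply_le_tsirelsonIter (s : ℕ) (x : ℕ+ →₀ ℝ) (n : ℕ+) :
    ‖x n‖ₑ ≤ tsirelsonIter 𝓕 θ s x := by
  cases s with
  | zero => exact le_iSup (fun n => ‖x n‖ₑ) n
  | succ s => exact (le_iSup (fun n => ‖x n‖ₑ) n).trans (le_max_left _ _)

theorem tsirelsonIter_mono (x : ℕ+ →₀ ℝ) : Monotone fun s => tsirelsonIter 𝓕 θ s x := by
  refine monotone_nat_of_le_succ fun s => ?_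
  induction s generalizing x with
  | zero => exact le_max_left _ _
  | succ s ih =>
    refine max_le_max le_rfl (mul_le_mul_right ?_ _)
    exact iSup_mono fun k => iSup_mono fun E => iSup_mono fun _ => Finset.sum_le_sum fun i _ => ih _

theorem tsirelsonIter_add_le (s : ℕ) (x y : ℕ+ →₀ ℝ) :
    tsirelsonIter 𝓕 θ s (x + y) ≤ tsirelsonIter 𝓕 θ s x + tsirelsonIter 𝓕 θ s y := by
  have key : ∀ (t : ℕ) (n : ℕ+), ‖(x + y) n‖ₑ ≤ tsirelsonIter 𝓕 θ t x + tsirelsonIter 𝓕 θ t y :=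
    fun t n => (enorm_add_le _ _).trans
      (add_le_add (enorm_apply_le_tsirelsonIter _ _ _) (enorm_apply_le_tsirelsonIter _ _ _))
  induction s generalizing x y with
  | zero => exact iSup_le (key 0)
  | succ s ih =>
    refine max_le (iSup_le (key _)) ?_
    have : tsirelsonIter 𝓕 θ (s + 1) x + tsirelsonIter 𝓕 θ (s + 1) y ≥ _ :=
      add_le_add (le_max_right _ _) (le_max_right _ _)
    refine le_trans ?_ this
    rw [← mul_add]
    refine mul_le_mul_right (iSup_le fun k => iSup_le fun E => iSup_le fun hE => ?_) _
    calc ∑ i, tsirelsonIter 𝓕 θ s (proj (E i) (x + y))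
        ≤ ∑ i, (tsirelsonIter 𝓕 θ s (proj (E i) x) + tsirelsonIter 𝓕 θ s (proj (E i) y)) := by
          refine Finset.sum_le_sum fun i _ => ?_
          have : proj (E i) (x + y) = proj (E i) x + proj (E i) y := Finsupp.filter_add
          rw [this]
          exact ih _ _ fun t n => (enorm_add_le _ _).trans
            (add_le_add (enorm_apply_le_tsirelsonIter _ _ _) (enorm_apply_le_tsirelsonIter _ _ _))
      _ = ∑ i, tsirelsonIter 𝓕 θ s (proj (E i) x) + ∑ i, tsirelsonIter 𝓕 θ s (proj (E i) y) :=
          Finset.sum_add_distrib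
      _ ≤ _ := add_le_add
          (le_iSup_isAdmissible (fun k E => ∑ i : Fin k, tsirelsonIter 𝓕 θ s (proj (E i) x)) hE)
          (le_iSup_isAdmissible (fun k E => ∑ i : Fin k, tsirelsonIter 𝓕 θ s (proj (E i) y)) hE)

theorem tsirelsonIter_smul (s : ℕ) (c : ℝ) (x : ℕ+ →₀ ℝ) :
    tsirelsonIter 𝓕 θ s (c • x) = ‖c‖ₑ * tsirelsonIter 𝓕 θ s x := by
  have h0 : (⨆ n, ‖(c • x) n‖ₑ) = ‖c‖ₑ * ⨆ n, ‖x n‖ₑ := by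
    simp [ENNReal.mul_iSup, enorm_mul]
  induction s generalizing x with
  | zero => exact h0
  | succ s ih =>
    simp only [tsirelsonIter]
    rw [h0, mul_max, mul_left_comm ‖c‖ₑ]
    congr 2
    simp only [ENNReal.mul_iSup, Finset.mul_sum]
    refine iSup_congr fun k => iSup_congr fun E => iSup_congr fun hE =>
      Finset.sum_congr rfl fun i _ => ?_
    have : proj (E i) (c • x) = c • proj (E i) x := Finsupp.filter_smul
    rw [this]
    exact ih _ (by simp [ENNReal.mul_iSup, enorm_mul])

theorem IsAdmissible.disjoint {k : ℕ} {E : Fin k → Finset ℕ+}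
    (hE : IsAdmissible 𝓕 fun i => (E i : Set ℕ+)) {i j : Fin k} (hij : i ≠ j) {n : ℕ+}
    (hi : n ∈ E i) (hj : n ∈ E j) : False := by
  rcases lt_or_gt_of_ne hij with h | h
  · exact lt_irrefl _ (hE.1 i j h n (by simpa using hi) n (by simpa using hj))
  · exact lt_irrefl _ (hE.1 j i h n (by simpa using hj) n (by simpa using hi))

theorem tsirelsonIter_le_sum (hθ : θ ≤ 1) (s : ℕ) (x : ℕ+ →₀ ℝ) (A : Finset ℕ+)
    (hA : x.support ⊆ A) : tsirelsonIter 𝓕 θ s x ≤ ∑ n ∈ A, ‖x n‖ₑ := by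
  have h0 : (⨆ n, ‖x n‖ₑ) ≤ ∑ n ∈ A, ‖x n‖ₑ := by
    refine iSup_le fun n => ?_
    by_cases hn : x n = 0
    · simp [hn]
    · exact Finset.single_le_sum (f := fun n => ‖x n‖ₑ) (fun _ _ => zero_le)
        (hA (Finsupp.mem_support_iff.2 hn))
  induction s generalizing x with
  | zero => exact h0
  | succ s ih =>
    refine max_le h0 ?_
    refine le_trans (mul_le_of_le_one_left' (ENNReal.ofReal_le_one.2 hθ)) ?_
    refine iSup_le fun k => iSup_le fun E => iSup_le fun hE => ?_
    have hs : ∀ i, (proj (E i) x).support ⊆ A := fun i =>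
      (Finsupp.support_filter (p := (· ∈ E i)) (f := x) ▸ Finset.filter_subset _ _).trans hA
    calc ∑ i, tsirelsonIter 𝓕 θ s (proj (E i) x)
        ≤ ∑ i, ∑ n ∈ A, ‖proj (E i) x n‖ₑ := by
          refine Finset.sum_le_sum fun i _ => ih _ (hs i) (iSup_le fun n => ?_)
          by_cases hn : proj (E i) x n = 0
          · simp [hn]
          · exact Finset.single_le_sum (f := fun n => ‖proj (E i) x n‖ₑ) (fun _ _ => zero_le)
              (hs i (Finsupp.mem_support_iff.2 hn))
      _ = ∑ n ∈ A, ∑ i, ‖proj (E i) x n‖ₑ := Finset.sum_comm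
      _ ≤ ∑ n ∈ A, ‖x n‖ₑ := by
          refine Finset.sum_le_sum fun n _ => ?_
          by_cases h : ∃ i, n ∈ E i
          · obtain ⟨i, hi⟩ := h
            rw [Finset.sum_eq_single i]
            · simp [proj, hi]
            · intro j _ hji
              have : n ∉ E j := fun hj => hE.disjoint hji hj hi
              simp [proj, this]
            · simp
          · push Not at h
            simp [proj, h]

theorem iSup_tsirelsonIter_ne_top (hθ : θ ≤ 1) (x : ℕ+ →₀ ℝ) :
    ⨆ s, tsirelsonIter 𝓕 θ s x ≠ ∞ := by
  refine ne_top_of_le_ne_top ?_ (iSup_le fun s => tsirelsonIter_le_sum hθ s x _ subset_rfl)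
  exact ENNReal.sum_ne_top.2 fun _ _ => enorm_ne_top

theorem tsirelsonNorm_nonneg (x : ℕ+ →₀ ℝ) : 0 ≤ tsirelsonNorm 𝓕 θ x := ENNReal.toReal_nonneg

theorem abs_apply_le_tsirelsonNorm (hθ : θ ≤ 1) (x : ℕ+ →₀ ℝ) (n : ℕ+) :
    |x n| ≤ tsirelsonNorm 𝓕 θ x := by
  have := ENNReal.toReal_mono (iSup_tsirelsonIter_ne_top (𝓕 := 𝓕) hθ x)
    (le_iSup_of_le 0 (enorm_apply_le_tsirelsonIter 0 x n))
  simpa [tsirelsonNorm] using this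

theorem tsirelsonNorm_add_le (hθ : θ ≤ 1) (x y : ℕ+ →₀ ℝ) :
    tsirelsonNorm 𝓕 θ (x + y) ≤ tsirelsonNorm 𝓕 θ x + tsirelsonNorm 𝓕 θ y := by
  have hx := iSup_tsirelsonIter_ne_top (𝓕 := 𝓕) hθ x
  have hy := iSup_tsirelsonIter_ne_top (𝓕 := 𝓕) hθ y
  unfold tsirelsonNorm
  rw [← ENNReal.toReal_add hx hy]
  refine ENNReal.toReal_mono (ENNReal.add_ne_top.2 ⟨hx, hy⟩) (iSup_le fun s => ?_)
  exact (tsirelsonIter_add_le s x y).trans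
    (add_le_add (le_iSup (fun s => tsirelsonIter 𝓕 θ s x) s)
      (le_iSup (fun s => tsirelsonIter 𝓕 θ s y) s))

theorem tsirelsonNorm_smul (c : ℝ) (x : ℕ+ →₀ ℝ) :
    tsirelsonNorm 𝓕 θ (c • x) = |c| * tsirelsonNorm 𝓕 θ x := by
  simp only [tsirelsonNorm, tsirelsonIter_smul, ← ENNReal.mul_iSup, ENNReal.toReal_mul]
  simp

theorem tsirelsonNorm_zero : tsirelsonNorm 𝓕 θ 0 = 0 := by
  simpa using tsirelsonNorm_smul (𝓕 := 𝓕) (θ := θ) 0 0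

theorem iSup_tsirelsonIter_eq (x : ℕ+ →₀ ℝ) :
    ⨆ s, tsirelsonIter 𝓕 θ s x = max (⨆ n, ‖x n‖ₑ) (ENNReal.ofReal θ *
      ⨆ (k : ℕ) (E : Fin k → Finset ℕ+) (_ : IsAdmissible 𝓕 fun i => (E i : Set ℕ+)),
        ∑ i, ⨆ s, tsirelsonIter 𝓕 θ s (proj (E i) x)) := by
  apply le_antisymm
  · refine iSup_le fun s => ?_
    cases s with
    | zero => exact le_max_left _ _
    | succ s =>
      refine max_le_max le_rfl (mul_le_mul_right ?_ _)
      exact iSup_mono fun k => iSup_mono fun E => iSup_mono fun _ => Finset.sum_le_sum fun i _ =>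
        le_iSup (fun s => tsirelsonIter 𝓕 θ s (proj (E i) x)) s
  · refine max_le (le_iSup_of_le 0 le_rfl) ?_
    simp only [ENNReal.mul_iSup]
    refine iSup_le fun k => iSup_le fun E => iSup_le fun hE => ?_
    rw [ENNReal.finsetSum_iSup_of_monotone fun i => tsirelsonIter_mono _, ENNReal.mul_iSup]
    refine iSup_le fun s => le_iSup_of_le (s + 1) (le_trans ?_ (le_max_right _ _))
    exact mul_le_mul_right
      (le_iSup_isAdmissible (fun k E => ∑ i : Fin k, tsirelsonIter 𝓕 θ s (proj (E i) x)) hE) _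

theorem bddAbove_range_abs (x : ℕ+ →₀ ℝ) : BddAbove (Set.range fun n => |x n|) :=
  ⟨tsirelsonNorm ∅ 1 x, by rintro _ ⟨n, rfl⟩; exact abs_apply_le_tsirelsonNorm le_rfl x n⟩

theorem mul_le_tsirelsonNorm (hθ : 0 < θ) (hθ' : θ ≤ 1) (x : ℕ+ →₀ ℝ) :
    ∀ r ∈ admissibleSums 𝓕 (tsirelsonNorm 𝓕 θ) x, θ * r ≤ tsirelsonNorm 𝓕 θ x := by
  rintro r ⟨k, E, hE, rfl⟩
  have htop := iSup_tsirelsonIter_ne_top (𝓕 := 𝓕) hθ'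
  have h : ENNReal.ofReal θ * ∑ i, ⨆ s, tsirelsonIter 𝓕 θ s (proj (E i) x) ≤
      ⨆ s, tsirelsonIter 𝓕 θ s x := by
    rw [iSup_tsirelsonIter_eq x]
    exact (mul_le_mul_right
      (le_iSup_isAdmissible
        (fun k E => ∑ i : Fin k, ⨆ s, tsirelsonIter 𝓕 θ s (proj (E i) x)) hE) _).trans (le_max_right _ _)
  have := ENNReal.toReal_mono (htop x) h
  rwa [ENNReal.toReal_mul, ENNReal.toReal_ofReal hθ.le,
    ENNReal.toReal_sum fun i _ => htop _] at this

/-- The Tsirelson norm solves the implicit equation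
`‖x‖ = max (‖x‖_∞, θ sup {∑ ‖Eᵢ x‖ : (Eᵢ) is 𝓕-admissible})`, with a finite supremum. -/
theorem tsirelsonNorm_eq (hθ : 0 < θ) (hθ' : θ ≤ 1) (x : ℕ+ →₀ ℝ) :
    BddAbove (admissibleSums 𝓕 (tsirelsonNorm 𝓕 θ) x) ∧
      tsirelsonNorm 𝓕 θ x =
        max (⨆ n, |x n|) (θ * sSup (admissibleSums 𝓕 (tsirelsonNorm 𝓕 θ) x)) := by
  have hle := mul_le_tsirelsonNorm (𝓕 := 𝓕) hθ hθ' x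
  have htop := iSup_tsirelsonIter_ne_top (𝓕 := 𝓕) hθ'
  have hnonneg : ∀ r ∈ admissibleSums 𝓕 (tsirelsonNorm 𝓕 θ) x, 0 ≤ r := by
    rintro r ⟨k, E, hE, rfl⟩
    exact Finset.sum_nonneg fun i _ => tsirelsonNorm_nonneg _
  have hbdd : BddAbove (admissibleSums 𝓕 (tsirelsonNorm 𝓕 θ) x) :=
    ⟨tsirelsonNorm 𝓕 θ x / θ, fun r hr => by
      rw [le_div_iff₀ hθ, mul_comm]; exact hle r hr⟩
  have hS : 0 ≤ sSup (admissibleSums 𝓕 (tsirelsonNorm 𝓕 θ) x) := Real.sSup_nonneg hnonneg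
  refine ⟨hbdd, le_antisymm ?_ (max_le (ciSup_le (abs_apply_le_tsirelsonNorm hθ' x)) ?_)⟩
  · refine ENNReal.toReal_le_of_le_ofReal (le_max_of_le_right (by positivity)) ?_
    rw [iSup_tsirelsonIter_eq x]
    refine max_le (iSup_le fun n => ?_) ?_
    · rw [← ofReal_norm]
      exact ENNReal.ofReal_le_ofReal
        ((le_ciSup (bddAbove_range_abs x) n).trans (le_max_left _ _))
    · refine le_trans ?_ (ENNReal.ofReal_le_ofReal (le_max_right _ _))
      rw [ENNReal.ofReal_mul hθ.le]
      refine mul_le_mul_right (iSup_le fun k => iSup_le fun E => iSup_le fun hE => ?_) _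
      refine ENNReal.le_ofReal_iff_toReal_le
        (ENNReal.sum_ne_top.2 fun i _ => htop _) hS |>.2 ?_
      rw [ENNReal.toReal_sum fun i _ => htop _]
      exact le_csSup hbdd ⟨k, E, hE, rfl⟩
  · rw [mul_comm, ← le_div_iff₀ hθ]
    refine Real.sSup_le (fun r hr => ?_) (div_nonneg (tsirelsonNorm_nonneg _) hθ.le)
    rw [le_div_iff₀ hθ, mul_comm]; exact hle r hr

/-- Comparison of two solutions of the implicit equation, one of which vanishes at `0`. -/
theorem implicit_le (hθ : 0 < θ) (hθ' : θ < 1) (N M : (ℕ+ →₀ ℝ) → ℝ) (hN0 : N 0 = 0)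
    (hM0 : ∀ x, 0 ≤ M x)
    (hN : ∀ x, N x = max (⨆ n, |x n|) (θ * sSup (admissibleSums 𝓕 N x)))
    (hM : ∀ x, BddAbove (admissibleSums 𝓕 M x) ∧
      M x = max (⨆ n, |x n|) (θ * sSup (admissibleSums 𝓕 M x))) (x : ℕ+ →₀ ℝ) :
    N x ≤ M x := by
  induction hc : x.support.card using Nat.strong_induction_on generalizing x with
  | _ c ih =>
  by_contra! hlt
  have hNx : 0 < N x := (hM0 x).trans_lt hlt
  have hsup : ⨆ n, |x n| ≤ M x := (hM x).2 ▸ le_max_left _ _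
  have hMS : θ * sSup (admissibleSums 𝓕 M x) ≤ M x := by
    conv_rhs => rw [(hM x).2]
    exact le_max_right _ _
  have hlt' : max (M x / θ) (N x) < N x / θ := by
    refine max_lt (by gcongr) ?_
    rw [lt_div_iff₀ hθ]; nlinarith
  have hS : sSup (admissibleSums 𝓕 N x) ≤ max (M x / θ) (N x) := by
    refine Real.sSup_le ?_ (le_max_of_le_right hNx.le)
    rintro r ⟨k, E, hE, rfl⟩
    by_cases h : ∃ i, x.support ⊆ E i
    · obtain ⟨i, hi⟩ := h
      refine le_max_of_le_right (le_of_eq ?_)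
      rw [Finset.sum_eq_single i]
      · congr 1
        exact (Finsupp.filter_eq_self_iff _ _).2 fun n hn => hi (Finsupp.mem_support_iff.2 hn)
      · intro j _ hji
        have : proj (E j) x = 0 := (Finsupp.filter_eq_zero_iff _ _).2 fun n hn => by
          by_contra hx
          exact hE.disjoint hji hn (hi (Finsupp.mem_support_iff.2 hx))
        rw [this, hN0]
      · simp
    · push Not at h
      refine le_max_of_le_left ?_
      have h1 : ∑ i, N (proj (E i) x) ≤ ∑ i, M (proj (E i) x) := by
        refine Finset.sum_le_sum fun i _ => ih _ ?_ _ rfl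
        rw [← hc]
        refine Finset.card_lt_card ((Finset.ssubset_iff_subset_ne).2 ⟨?_, fun heq => h i ?_⟩)
        · exact Finsupp.support_filter (p := (· ∈ E i)) (f := x) ▸ Finset.filter_subset _ _
        · rw [← heq]
          intro n hn
          have := Finsupp.support_filter (p := (· ∈ E i)) (f := x) ▸ hn
          exact (Finset.mem_filter.1 this).2
      refine h1.trans ?_
      rw [le_div_iff₀ hθ, mul_comm]
      exact (mul_le_mul_of_nonneg_left (le_csSup (hM x).1 ⟨k, E, hE, rfl⟩) hθ.le).trans hMS
  have : N x ≤ max (M x) (θ * max (M x / θ) (N x)) := by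
    conv_lhs => rw [hN x]
    exact max_le_max hsup (mul_le_mul_of_nonneg_left hS hθ.le)
  rcases le_max_iff.1 this with h | h
  · exact absurd h (not_le.2 hlt)
  · rw [lt_div_iff₀ hθ] at hlt'
    linarith

/-- The Tsirelson norm is the only solution of the implicit equation that vanishes at `0`. -/
theorem tsirelsonNorm_unique (hθ : 0 < θ) (hθ' : θ < 1) (N : (ℕ+ →₀ ℝ) → ℝ) (hN0 : N 0 = 0)
    (hN : ∀ x, BddAbove (admissibleSums 𝓕 N x) ∧
      N x = max (⨆ n, |x n|) (θ * sSup (admissibleSums 𝓕 N x))) : N = tsirelsonNorm 𝓕 θ := by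
  have hpos : ∀ x, 0 ≤ N x := fun x => by
    rw [(hN x).2]
    exact le_max_of_le_left (Real.iSup_nonneg fun n => abs_nonneg _)
  funext x
  exact le_antisymm
    (implicit_le hθ hθ' N _ hN0 tsirelsonNorm_nonneg (fun x => (hN x).2)
      (tsirelsonNorm_eq hθ hθ'.le) x)
    (implicit_le hθ hθ' _ N tsirelsonNorm_zero hpos (fun x => (tsirelsonNorm_eq hθ hθ'.le x).2)
      hN x)

end TsirelsonNorm

/-- The space `c₀₀` of finitely supported real sequences, equipped with the Tsirelson norm
for the family `𝓕` and the number `θ ∈ (0, 1)`. -/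
def TsirelsonC00 (_𝓕 : Set (Finset ℕ+)) (_θ : Set.Ioo (0 : ℝ) 1) : Type := ℕ+ →₀ ℝ

noncomputable section

variable (𝓕 : Set (Finset ℕ+)) (θ : Set.Ioo (0 : ℝ) 1)

instance : AddCommGroup (TsirelsonC00 𝓕 θ) := inferInstanceAs (AddCommGroup (ℕ+ →₀ ℝ))

instance : Module ℝ (TsirelsonC00 𝓕 θ) := inferInstanceAs (Module ℝ (ℕ+ →₀ ℝ))

instance : Norm (TsirelsonC00 𝓕 θ) := ⟨fun x => tsirelsonNorm 𝓕 θ x⟩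

theorem TsirelsonC00.core : NormedSpace.Core ℝ (TsirelsonC00 𝓕 θ) where
  norm_nonneg x := tsirelsonNorm_nonneg (𝓕 := 𝓕) (θ := θ) x
  norm_smul c x := tsirelsonNorm_smul (𝓕 := 𝓕) (θ := θ) c x
  norm_triangle x y := tsirelsonNorm_add_le (𝓕 := 𝓕) θ.2.2.le x y
  norm_eq_zero_iff x := by
    refine ⟨fun h => Finsupp.ext fun n => ?_, fun h => h ▸ tsirelsonNorm_zero⟩
    exact abs_nonpos_iff.1
      ((abs_apply_le_tsirelsonNorm (𝓕 := 𝓕) θ.2.2.le (x : ℕ+ →₀ ℝ) n).trans (le_of_eq h))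

instance : NormedAddCommGroup (TsirelsonC00 𝓕 θ) :=
  NormedAddCommGroup.ofCore (TsirelsonC00.core 𝓕 θ)

instance : NormedSpace ℝ (TsirelsonC00 𝓕 θ) :=
  NormedSpace.ofCore (TsirelsonC00.core 𝓕 θ)

/-- The Tsirelson space `T[𝓕, θ]`: the completion of `c₀₀` under the Tsirelson norm. -/
abbrev TsirelsonSpace : Type := UniformSpace.Completion (TsirelsonC00 𝓕 θ)

variable {𝓕 θ}

/-- The `n`-th coordinate functional on `c₀₀`. -/
def TsirelsonC00.coord (n : ℕ+) : TsirelsonC00 𝓕 θ →L[ℝ] ℝ :=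
  LinearMap.mkContinuous (Finsupp.lapply n : (ℕ+ →₀ ℝ) →ₗ[ℝ] ℝ) 1 fun x =>
    (abs_apply_le_tsirelsonNorm (𝓕 := 𝓕) θ.2.2.le (x : ℕ+ →₀ ℝ) n).trans (one_mul _).ge

/-- The `n`-th coordinate functional on `T[𝓕, θ]`: the continuous extension of the one on `c₀₀`. -/
def TsirelsonSpace.coord (n : ℕ+) : TsirelsonSpace 𝓕 θ →L[ℝ] ℝ :=
  (TsirelsonC00.coord n).fromCompletion

/-- The support of a vector of `T[𝓕, θ]`: the set of its nonzero coordinates. -/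
def TsirelsonSpace.supp (y : TsirelsonSpace 𝓕 θ) : Set ℕ+ := {n | TsirelsonSpace.coord n y ≠ 0}

end

/-!
Unfolding the norms `‖y j‖` turns the left-hand side into a functional along a tree in which the
children of a node are only an allowable sequence. On each level, however, the nodes can be
regrouped into successive sets: a finite subset of a union of sets `A j ∈ 𝓢_ξ` with `v j ≤ A j` is
a union of successive members of `𝓢_ξ`, of which at most as many meet `[1, p]` as there are `j` with
`v j ≤ p`. Only the leaves interrupt the resulting blocks, and separating every second leaf of a
level costs no more additional blocks than the level has leaves. Hence the leaves of even rank in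
their level, those of odd rank at least three, and the first leaves of the levels give three
functionals bounded by the norm.
-/

section Counting

variable {ι : Type*} [LinearOrder ι] {P Q : Finset ι} {m n : ι}

/-- The counting function of a finite set `P`; for `n ∈ P` it is the rank of `n` in `P`,
starting from `1`. -/
def countLE (P : Finset ι) (n : ι) : ℕ := (P.filter (· ≤ n)).card

theorem countLE_monotone (P : Finset ι) : Monotone (countLE P) := fun _ _ h =>
  Finset.card_le_card (Finset.monotone_filter_right P fun _ _ ha => ha.trans h)

theorem countLE_le_card (P : Finset ι) (n : ι) : countLE P n ≤ P.card :=
  Finset.card_filter_le _ _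

theorem countLE_mono_left (h : P ⊆ Q) (n : ι) : countLE P n ≤ countLE Q n :=
  Finset.card_le_card (Finset.filter_subset_filter _ h)

theorem countLE_eq_zero (h : ∀ p ∈ P, n < p) : countLE P n = 0 := by
  rw [countLE, Finset.filter_false_of_mem fun p hp => (h p hp).not_ge, Finset.card_empty]

theorem countLE_le_one (h : ∀ p ∈ P, n ≤ p) : countLE P n ≤ 1 :=
  Finset.card_le_one.2 fun p hp q hq => by
    obtain ⟨hp, hpn⟩ := Finset.mem_filter.1 hp
    obtain ⟨hq, hqn⟩ := Finset.mem_filter.1 hq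
    exact (hpn.antisymm (h p hp)).trans (hqn.antisymm (h q hq)).symm

theorem countLE_pos (hn : n ∈ P) : 1 ≤ countLE P n :=
  Finset.card_pos.2 ⟨n, Finset.mem_filter.2 ⟨hn, le_rfl⟩⟩

theorem countLE_lt (hn : n ∈ P) (h : m < n) : countLE P m < countLE P n :=
  Finset.card_lt_card <| (Finset.ssubset_iff_of_subset
    (Finset.monotone_filter_right P fun _ _ ha => ha.trans h.le)).2
    ⟨n, Finset.mem_filter.2 ⟨hn, le_rfl⟩, fun hnm => (Finset.mem_filter.1 hnm).2.not_gt h⟩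

theorem le_of_countLE_le (hm : m ∈ P) (h : countLE P m ≤ countLE P n) : m ≤ n :=
  not_lt.1 fun hlt => (countLE_lt hm hlt).not_ge h

theorem countLE_injOn (P : Finset ι) : Set.InjOn (countLE P) P :=
  StrictMonoOn.injOn fun _ _ _ hn h => countLE_lt hn h

theorem countLE_union (h : Disjoint P Q) (n : ι) :
    countLE (P ∪ Q) n = countLE P n + countLE Q n := by
  rw [countLE, Finset.filter_union, Finset.card_union_of_disjoint (h.mono
    (Finset.filter_subset _ _) (Finset.filter_subset _ _))]
  rfl

theorem exists_mem_countLE_eq {j : ℕ} (h1 : 1 ≤ j) (hj : j ≤ P.card) :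
    ∃ n ∈ P, countLE P n = j := by
  have himage : P.image (countLE P) = Finset.Icc 1 P.card :=
    Finset.eq_of_subset_of_card_le
      (Finset.image_subset_iff.2 fun n hn =>
        Finset.mem_Icc.2 ⟨countLE_pos hn, countLE_le_card P n⟩)
      (by rw [Finset.card_image_of_injOn (countLE_injOn P), Nat.card_Icc, Nat.add_sub_cancel])
  exact Finset.mem_image.1 (himage ▸ Finset.mem_Icc.2 ⟨h1, hj⟩)

/-- The step function that increases by one both at and immediately after every point of `S`,
so that it separates the points of `S` from all others. -/
def cut (S : Finset ι) (n : ι) : ℕ := countLE S n + (S.filter (· < n)).card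

theorem cut_monotone (S : Finset ι) : Monotone (cut S) := fun _ _ h =>
  add_le_add (countLE_monotone S h)
    (Finset.card_le_card (Finset.monotone_filter_right S fun _ _ ha => ha.trans_le h))

theorem cut_le_two_mul_countLE (S : Finset ι) (n : ι) : cut S n ≤ 2 * countLE S n := by
  rw [two_mul]
  exact add_le_add_right
    (Finset.card_le_card (Finset.monotone_filter_right S fun _ _ ha => ha.le)) _

theorem one_le_cut {S : Finset ι} (hn : n ∈ S) : 1 ≤ cut S n :=
  (countLE_pos hn).trans (Nat.le_add_right _ _)

theorem cut_lt_cut {S : Finset ι} (h : m < n) (hS : m ∈ S ∨ n ∈ S) : cut S m < cut S n := by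
  have hlt : (S.filter (· < m)).card ≤ (S.filter (· < n)).card :=
    Finset.card_le_card (Finset.monotone_filter_right S fun _ _ ha => ha.trans h)
  rcases hS with hm | hn
  · refine add_lt_add_of_le_of_lt (countLE_monotone S h.le) (Finset.card_lt_card ?_)
    exact (Finset.ssubset_iff_of_subset
      (Finset.monotone_filter_right S fun _ _ ha => ha.trans h)).2
      ⟨m, Finset.mem_filter.2 ⟨hm, h⟩, fun hmm => lt_irrefl _ (Finset.mem_filter.1 hmm).2⟩
  · exact add_lt_add_of_lt_of_le (countLE_lt hn h) hlt

theorem eq_of_cut_eq {S : Finset ι} (hm : m ∈ S) (h : cut S m = cut S n) : m = n := by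
  rcases lt_trichotomy m n with hlt | heq | hlt
  · exact absurd h (cut_lt_cut hlt (.inl hm)).ne
  · exact heq
  · exact absurd h (cut_lt_cut hlt (.inr hm)).ne'

/-- Every second element of `Λ`, beginning with the one of rank `c + 2`. -/
def everySecond (c : ℕ) (Λ : Finset ι) : Finset ι :=
  Λ.filter fun n => Even (countLE Λ n - c) ∧ c + 2 ≤ countLE Λ n

theorem mem_everySecond_iff {c : ℕ} :
    n ∈ everySecond c P ↔ n ∈ P ∧ Even (countLE P n - c) ∧ c + 2 ≤ countLE P n :=
  Finset.mem_filter

theorem countLE_everySecond_le (c : ℕ) (Λ : Finset ι) (n : ι) :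
    countLE (everySecond c Λ) n ≤ (countLE Λ n - c) / 2 := by
  calc countLE (everySecond c Λ) n
      ≤ (Finset.Icc 1 ((countLE Λ n - c) / 2)).card := by
        refine Finset.card_le_card_of_injOn (fun s => (countLE Λ s - c) / 2)
          (fun s hs => ?_) fun s hs t ht hst => ?_
        · obtain ⟨hs, hsn⟩ := Finset.mem_filter.1 hs
          have hrank := (mem_everySecond_iff.1 hs).2.2
          have := countLE_monotone Λ hsn
          simp only [Finset.coe_Icc, Set.mem_Icc]
          omega
        · obtain ⟨hsΛ, ⟨a, ha⟩, hs2⟩ := mem_everySecond_iff.1 (Finset.mem_filter.1 hs).1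
          obtain ⟨htΛ, ⟨b, hb⟩, ht2⟩ := mem_everySecond_iff.1 (Finset.mem_filter.1 ht).1
          replace hst : (countLE Λ s - c) / 2 = (countLE Λ t - c) / 2 := hst
          exact countLE_injOn Λ hsΛ htΛ (by omega)
    _ = (countLE Λ n - c) / 2 := by simp

theorem cut_everySecond_le (c : ℕ) (Λ : Finset ι) (n : ι) :
    cut (everySecond c Λ) n ≤ countLE Λ n - c := by
  have hcut := cut_le_two_mul_countLE (everySecond c Λ) n
  have hcount := countLE_everySecond_le c Λ n
  omega

theorem countLE_eq_one (hn : n ∈ P) (h0 : n ∉ everySecond 0 P) (h1 : n ∉ everySecond 1 P) :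
    countLE P n = 1 := by
  have hpos := countLE_pos hn
  simp only [mem_everySecond_iff, hn, true_and, Nat.even_iff] at h0 h1
  omega

end Counting

section Schreier

variable {α : Ordinal.{0} → ℕ+ → Ordinal.{0}} {γ ξ : Ordinal.{0}} {E F : Finset ℕ+} {n : ℕ+}

theorem schreier_zero_iff : E ∈ schreier α 0 ↔ E.card ≤ 1 := by
  constructor
  · intro h
    change SchreierMem α 0 E at h
    generalize h0 : (0 : Ordinal.{0}) = ζ at h
    cases h with
    | empty => simp
    | singleton n => simp
    | succ γ n E mem le lt => exact absurd h0.symm (Order.succ_ne_bot γ)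
    | limit ξ hξ n E mem le => exact absurd h0.symm hξ.ne_bot
  · intro h
    obtain ⟨n, hn⟩ := Finset.card_le_one_iff_subset_singleton.1 h
    rcases Finset.subset_singleton_iff.1 hn with rfl | rfl
    exacts [SchreierMem.empty, SchreierMem.singleton n]

theorem schreier_succ_iff :
    F ∈ schreier α (Order.succ γ) ↔ ∃ (n : ℕ+) (E : Fin n → Finset ℕ+),
      (∀ i, E i ∈ schreier α γ) ∧ (∀ m ∈ F, n ≤ m) ∧ (∀ i j, i < j → SetLT (E i) (E j)) ∧
        F = Finset.univ.biUnion E := by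
  constructor
  · intro h
    change SchreierMem α _ F at h
    generalize h0 : Order.succ γ = ζ at h
    cases h with
    | empty => exact absurd h0 (Order.succ_ne_bot γ)
    | singleton n => exact absurd h0 (Order.succ_ne_bot γ)
    | succ γ' n E mem le lt =>
      obtain rfl := Order.succ_injective h0
      refine ⟨n, E, mem, fun m hm => ?_, lt, rfl⟩
      obtain ⟨i, -, hi⟩ := Finset.mem_biUnion.1 hm
      exact le i m hi
    | limit ξ hξ n E mem le => exact absurd (h0 ▸ hξ) (Order.not_isSuccLimit_succ γ)
  · rintro ⟨n, E, mem, le, lt, rfl⟩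
    exact SchreierMem.succ γ n E mem
      (fun i m hm => le m (Finset.mem_biUnion.2 ⟨i, Finset.mem_univ _, hm⟩)) lt

theorem schreier_limit_iff (hl : Order.IsSuccLimit ξ) :
    F ∈ schreier α ξ ↔ ∃ n : ℕ+, F ∈ schreier α (α ξ n) ∧ ∀ m ∈ F, n ≤ m := by
  constructor
  · intro h
    change SchreierMem α ξ F at h
    cases h with
    | empty => exact absurd rfl hl.ne_bot
    | singleton n => exact absurd rfl hl.ne_bot
    | succ γ' n E mem le lt => exact absurd hl (Order.not_isSuccLimit_succ _)
    | limit ξ hξ n E mem le => exact ⟨n, mem, le⟩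
  · rintro ⟨n, mem, le⟩
    exact SchreierMem.limit ξ hl n F mem le

theorem mem_schreier_of_card_le_one (hα : IsApproximatingSystem α) (hξ : ξ < ω₁)
    (hF : F.card ≤ 1) : F ∈ schreier α ξ := by
  induction ξ using WellFoundedLT.induction with
  | _ ξ ih =>
  rcases Ordinal.zero_or_succ_or_isSuccLimit ξ with rfl | ⟨γ, rfl⟩ | hl
  · exact schreier_zero_iff.2 hF
  · refine schreier_succ_iff.2 ⟨1, fun _ => F, fun _ => ih γ (Order.lt_succ γ)
      ((Order.lt_succ γ).trans hξ), fun _ _ => one_le, fun i j hij => ?_, ?_⟩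
    · exact absurd (Subsingleton.elim (α := Fin 1) i j) hij.ne
    · ext m
      simp only [Finset.mem_biUnion, Finset.mem_univ, true_and]
      exact ⟨fun h => ⟨(0 : Fin 1), h⟩, fun ⟨_, h⟩ => h⟩
  · have hlt := hα.lt ξ hξ hl 1
    exact (schreier_limit_iff hl).2 ⟨1, ih _ hlt (hlt.trans hξ), fun _ _ => one_le⟩

theorem empty_mem_schreier (hα : IsApproximatingSystem α) (hξ : ξ < ω₁) :
    ∅ ∈ schreier α ξ :=
  mem_schreier_of_card_le_one hα hξ zero_le_one

theorem forall_le_of_spread {φ : ℕ+ → ℕ+} (hF : 1 < F.card) (hn : ∀ m ∈ F, n ≤ φ m)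
    (hle : ∀ a ∈ F, ∀ b ∈ F, a < b → φ a ≤ a) : ∀ m ∈ F, n ≤ m := by
  intro m hm
  obtain ⟨b, hb, hbm⟩ := Finset.exists_mem_ne hF m
  rcases hbm.lt_or_gt with h | h
  · exact (hn b hb).trans ((hle b hb m hm h).trans h.le)
  · exact (hn m hm).trans (hle m hm b hb h)

/-- Besides being spreading, Schreier families allow the last element of a set to move to the
left, up to its predecessor. -/
theorem mem_schreier_of_spread (hα : IsApproximatingSystem α) (hξ : ξ < ω₁)
    (hE : E ∈ schreier α ξ) (φ : ℕ+ → ℕ+) (hφ : StrictMonoOn φ F) (hmem : ∀ n ∈ F, φ n ∈ E)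
    (hle : ∀ a ∈ F, ∀ b ∈ F, a < b → φ a ≤ a) : F ∈ schreier α ξ := by
  by_cases hcard : F.card ≤ 1
  · exact mem_schreier_of_card_le_one hα hξ hcard
  change SchreierMem α ξ E at hE
  induction hE generalizing F with
  | empty =>
    exact absurd ((Finset.card_le_card_of_injOn φ hmem hφ.injOn).trans zero_le_one) hcard
  | singleton n =>
    exact absurd (Finset.card_le_card_of_injOn φ hmem hφ.injOn) hcard
  | succ γ n E _ le lt ih =>
    have hγ : γ < ω₁ := (Order.lt_succ γ).trans hξ
    have hmem' : ∀ m ∈ F, ∃ i, φ m ∈ E i := fun m hm => by simpa using hmem m hm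
    refine schreier_succ_iff.2 ⟨n, fun i => F.filter (φ · ∈ E i), fun i => ?_,
      forall_le_of_spread (not_le.1 hcard) (fun m hm => (hmem' m hm).elim (le · _)) hle,
      fun i j hij a ha b hb => ?_, ?_⟩
    · have hsub := Finset.filter_subset (φ · ∈ E i) F
      by_cases hi : (F.filter (φ · ∈ E i)).card ≤ 1
      · exact mem_schreier_of_card_le_one hα hγ hi
      · exact ih i hγ (hφ.mono hsub) (fun m hm => (Finset.mem_filter.1 hm).2)
          (fun a ha b hb => hle a (hsub ha) b (hsub hb)) hi
    · simp only [Finset.coe_filter, Set.mem_ofPred_eq] at ha hb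
      exact (hφ.lt_iff_lt ha.1 hb.1).1 (lt i j hij _ ha.2 _ hb.2)
    · ext m
      simpa using hmem' m
  | limit ζ hζ n E _ le ih =>
    exact (schreier_limit_iff hζ).2 ⟨n, ih ((hα.lt ζ hξ hζ n).trans hξ) hφ hmem hle hcard,
      forall_le_of_spread (not_le.1 hcard) (fun m hm => le _ (hmem m hm)) hle⟩

theorem schreier_subset (hα : IsApproximatingSystem α) (hξ : ξ < ω₁) (hE : E ∈ schreier α ξ)
    (h : F ⊆ E) : F ∈ schreier α ξ :=
  mem_schreier_of_spread hα hξ hE id strictMonoOn_id (fun _ hn => h hn) fun _ _ _ _ _ => le_rfl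

theorem eq_one_of_one_mem_schreier (hE : E ∈ schreier α ξ) (h : 1 ∈ E) : ∀ n ∈ E, n = 1 := by
  change SchreierMem α ξ E at hE
  induction hE with
  | empty => simp
  | singleton n => simp_all
  | succ γ n E mem le lt ih =>
    obtain ⟨i, -, hi⟩ := Finset.mem_biUnion.1 h
    obtain rfl : n = 1 := le_antisymm (le i 1 hi) one_le
    intro m hm
    obtain ⟨j, -, hj⟩ := Finset.mem_biUnion.1 hm
    obtain rfl := Subsingleton.elim (α := Fin 1) i j
    exact ih i hi m hj
  | limit _ _ _ _ _ _ ih => exact ih h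

theorem mem_schreier_succ_of_monotoneOn (hn : ∀ m ∈ F, n ≤ m) {u : ℕ+ → ℕ} (c : ℕ)
    (hmono : MonotoneOn u F) (hlt : ∀ m ∈ F, c < u m) (hle : ∀ m ∈ F, u m ≤ c + n)
    (hfiber : ∀ i, F.filter (u · = i) ∈ schreier α γ) : F ∈ schreier α (Order.succ γ) := by
  refine schreier_succ_iff.2 ⟨n, fun i => F.filter (u · = c + 1 + i), fun i => hfiber _, hn,
    fun i j hij a ha b hb => ?_, ?_⟩
  · simp only [Finset.coe_filter, Set.mem_ofPred_eq] at ha hb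
    refine hmono.reflect_lt ha.1 hb.1 ?_
    have : (i : ℕ) < j := hij
    omega
  · ext m
    simp only [Finset.mem_biUnion, Finset.mem_univ, Finset.mem_filter, true_and]
    refine ⟨fun hm => ⟨⟨u m - (c + 1), ?_⟩, hm, ?_⟩, fun ⟨_, hm, _⟩ => hm⟩
    · have := hlt m hm
      have := hle m hm
      omega
    · have := hlt m hm
      dsimp only
      omega

theorem mem_schreier_of_card_le (hα : IsApproximatingSystem α) (hξ : ξ < ω₁) (h0 : ξ ≠ 0)
    (hF : F.card ≤ n) (hn : ∀ m ∈ F, n ≤ m) : F ∈ schreier α ξ := by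
  have mem_succ (γ) (hγ : γ < ω₁) : F ∈ schreier α (Order.succ γ) :=
    mem_schreier_succ_of_monotoneOn hn 0 ((countLE_monotone F).monotoneOn _)
      (fun m hm => countLE_pos hm) (fun m _ => by
        rw [zero_add]
        exact (countLE_le_card F m).trans hF) fun i =>
      mem_schreier_of_card_le_one hα hγ <| Finset.card_le_one.2 fun a ha b hb => by
        simp only [Finset.mem_filter] at ha hb
        exact countLE_injOn F ha.1 hb.1 (ha.2.trans hb.2.symm)
  rcases Ordinal.zero_or_succ_or_isSuccLimit ξ with rfl | ⟨γ, rfl⟩ | hl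
  · exact absurd rfl h0
  · exact mem_succ γ ((Order.lt_succ γ).trans hξ)
  · obtain ⟨γ, hγ⟩ := hα.exists_succ ξ hξ hl n
    have hlt := hα.lt ξ hξ hl n
    rw [hγ] at hlt
    exact (schreier_limit_iff hl).2
      ⟨n, hγ ▸ mem_succ γ (((Order.lt_succ γ).trans hlt).trans hξ), hn⟩

theorem schreier_limit_mono (hα : IsApproximatingSystem α) (hξ : ξ < ω₁)
    (hl : Order.IsSuccLimit ξ) (h1 : 1 ∉ F) {m : ℕ+} (hmn : m ≤ n)
    (hF : F ∈ schreier α (α ξ m)) : F ∈ schreier α (α ξ n) := by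
  induction n using PNat.recOn with
  | one => rwa [le_antisymm hmn one_le] at hF
  | succ n ih =>
    rcases hmn.eq_or_lt with rfl | h
    · exact hF
    · have hunion := hα.union_mem ξ hξ hl n F ∅ (ih (PNat.lt_add_one_iff.1 h))
        (empty_mem_schreier hα ((hα.lt ξ hξ hl n).trans hξ))
        (fun a ha b hb => by
          obtain rfl : a = 1 := ha
          exact lt_of_le_of_ne one_le fun h => h1 (h ▸ hb))
        (fun a _ b hb => by simp at hb)
      rwa [Finset.union_empty] at hunion

end Schreier

section Grouping

variable {α : Ordinal.{0} → ℕ+ → Ordinal.{0}} {γ ξ : Ordinal.{0}} {𝓕 : Set (Finset ℕ+)}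
  {F P R : Finset ℕ+} {b b₁ b₂ g g₁ g₂ : ℕ+ → ℕ}

/-- `P` is divided into successive members of `𝓕`, the point `p` lying in the group with the
number `g p`; groups are numbered from `1`, some may be empty, and the numbers respect the
bound `b`. -/
structure IsGrouping (𝓕 : Set (Finset ℕ+)) (P : Finset ℕ+) (b g : ℕ+ → ℕ) : Prop where
  monotoneOn : MonotoneOn g P
  one_le : ∀ p ∈ P, 1 ≤ g p
  le : ∀ p ∈ P, g p ≤ b p
  fiber_mem : ∀ i, P.filter (g · = i) ∈ 𝓕

/-- `P` is covered by members `A j` of `𝓕`, `j ∈ J`, such that `v j ≤ A j`. -/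
def IsCovered {κ : Type*} (𝓕 : Set (Finset ℕ+)) (J : Finset κ) (v : κ → ℕ+) (P : Finset ℕ+) :
    Prop :=
  ∃ A : κ → Finset ℕ+, (∀ j, A j ∈ 𝓕) ∧ (∀ j, ∀ n ∈ A j, v j ≤ n) ∧ P ⊆ J.biUnion A

/-- Finite sets covered by members of `𝓕` that start at given numbers `v j` can be grouped into
successive members of `𝓕`, the number of the group of `p` being at most `#{j | v j ≤ p}`. -/
def HasGrouping (𝓕 : Set (Finset ℕ+)) : Prop :=
  ∀ {κ : Type} (J : Finset κ) (v : κ → ℕ+) (P : Finset ℕ+), IsCovered 𝓕 J v P →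
    ∃ g, IsGrouping 𝓕 P (fun p => (J.filter (v · ≤ p)).card) g

namespace IsGrouping

theorem of_mem (hP : P ∈ 𝓕) (hempty : ∅ ∈ 𝓕) (hb : ∀ p ∈ P, 1 ≤ b p) :
    IsGrouping 𝓕 P b fun _ => 1 where
  monotoneOn := monotoneOn_const
  one_le _ _ := le_rfl
  le := hb
  fiber_mem i := by
    by_cases hi : 1 = i
    · rwa [Finset.filter_true_of_mem fun _ _ => hi]
    · rwa [Finset.filter_false_of_mem fun _ _ => hi]

theorem mono (h𝓕 : ∀ E ∈ 𝓕, ∀ F ⊆ E, F ∈ 𝓕) (h : IsGrouping 𝓕 P b₁ g) (hF : F ⊆ P)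
    (hle : ∀ p ∈ F, g p ≤ b p) : IsGrouping 𝓕 F b g where
  monotoneOn := h.monotoneOn.mono (Finset.coe_subset.2 hF)
  one_le p hp := h.one_le p (hF hp)
  le := hle
  fiber_mem i := h𝓕 _ (h.fiber_mem i) _ (Finset.filter_subset_filter _ hF)

theorem concat (hFR : SetLT (F : Set ℕ+) R) (h₁ : IsGrouping 𝓕 F b₁ g₁)
    (h₂ : IsGrouping 𝓕 R b₂ g₂) (c : ℕ) (hc : ∀ p ∈ F, b₁ p ≤ c) (hb₁ : ∀ p ∈ F, b₁ p ≤ b p)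
    (hb₂ : ∀ p ∈ R, c + b₂ p ≤ b p) :
    IsGrouping 𝓕 (F ∪ R) b fun p => if p ∈ F then g₁ p else c + g₂ p := by
  have hR {p} (hp : p ∈ R) : p ∉ F := fun hpF => lt_irrefl p (hFR p hpF p hp)
  have hmem {p} (hp : p ∈ F ∪ R) (hpF : p ∉ F) : p ∈ R := (Finset.mem_union.1 hp).resolve_left hpF
  have hle {p} (hp : p ∈ F) : g₁ p ≤ c := (h₁.le p hp).trans (hc p hp)
  refine ⟨fun p hp q hq hpq => ?_, fun p hp => ?_, fun p hp => ?_, fun i => ?_⟩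
  · by_cases hpF : p ∈ F <;> by_cases hqF : q ∈ F <;> simp only [hpF, hqF, if_true, if_false]
    · exact h₁.monotoneOn hpF hqF hpq
    · exact (hle hpF).trans (Nat.le_add_right _ _)
    · exact absurd (hFR q hqF p (hmem hp hpF)) hpq.not_gt
    · exact Nat.add_le_add_left (h₂.monotoneOn (hmem hp hpF) (hmem hq hqF) hpq) c
  · by_cases hpF : p ∈ F <;> simp only [hpF, if_true, if_false]
    · exact h₁.one_le p hpF
    · exact (h₂.one_le p (hmem hp hpF)).trans (Nat.le_add_left _ _)
  · by_cases hpF : p ∈ F <;> simp only [hpF, if_true, if_false]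
    · exact (h₁.le p hpF).trans (hb₁ p hpF)
    · exact (Nat.add_le_add_left (h₂.le p (hmem hp hpF)) c).trans (hb₂ p (hmem hp hpF))
  · have hpos := h₂.one_le
    by_cases hi : i ≤ c
    · convert h₁.fiber_mem i using 1
      ext p
      simp only [Finset.mem_filter, Finset.mem_union]
      grind
    · convert h₂.fiber_mem (i - c) using 1
      ext p
      simp only [Finset.mem_filter, Finset.mem_union]
      grind

theorem exists_append {κ : Type*} [DecidableEq κ] {s : Finset κ} {a : κ} {w : κ → ℕ+}
    (ha : a ∉ s) (hmax : ∀ j ∈ s, w j ≤ w a)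
    (hg : IsGrouping 𝓕 F (fun p => (s.filter (w · ≤ p)).card) g) (hFR : SetLT (F : Set ℕ+) R)
    (hR : R ∈ 𝓕) (hempty : ∅ ∈ 𝓕) (hw : ∀ p ∈ R, w a ≤ p) :
    ∃ g', IsGrouping 𝓕 (F ∪ R) (fun p => ((insert a s).filter (w · ≤ p)).card) g' := by
  refine ⟨_, hg.concat hFR (.of_mem (b := fun _ => 1) hR hempty fun _ _ => le_rfl) s.card
    (fun p _ => Finset.card_le_card (Finset.filter_subset _ _))
    (fun p _ => Finset.card_le_card (Finset.filter_subset_filter _ (Finset.subset_insert _ _)))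
    fun p hp => ?_⟩
  rw [Finset.filter_true_of_mem, Finset.card_insert_of_notMem ha]
  exact Finset.forall_mem_insert .. |>.2 ⟨hw p hp, fun j hj => (hmax j hj).trans (hw p hp)⟩

end IsGrouping

theorem hasGrouping_schreier_zero : HasGrouping (schreier α 0) := by
  rintro κ J v P ⟨A, hA, hv, hP⟩
  refine ⟨countLE P, (countLE_monotone P).monotoneOn _, fun p hp => countLE_pos hp,
    fun p _ => ?_, fun i => schreier_zero_iff.2 (Finset.card_le_one.2 fun a ha b hb => ?_)⟩
  · have hsub : P.filter (· ≤ p) ⊆ (J.filter (v · ≤ p)).biUnion A := fun q hq => by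
      obtain ⟨hqP, hqp⟩ := Finset.mem_filter.1 hq
      obtain ⟨j, hj, hqj⟩ := Finset.mem_biUnion.1 (hP hqP)
      exact Finset.mem_biUnion.2 ⟨j, Finset.mem_filter.2 ⟨hj, (hv j q hqj).trans hqp⟩, hqj⟩
    calc countLE P p ≤ ((J.filter (v · ≤ p)).biUnion A).card := Finset.card_le_card hsub
      _ ≤ (J.filter (v · ≤ p)).card * 1 :=
        Finset.card_biUnion_le_card_mul _ _ _ fun j _ => schreier_zero_iff.1 (hA j)
      _ = _ := mul_one _
  · simp only [Finset.mem_filter] at ha hb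
    exact countLE_injOn P ha.1 hb.1 (ha.2.trans hb.2.symm)

theorem IsGrouping.mem_schreier_succ {c : ℕ} {n : ℕ+}
    (h : IsGrouping (schreier α γ) P (fun _ => c + n) g) (hn : ∀ p ∈ P, n ≤ p)
    (hc : ∀ p ∈ P, c < g p) : P ∈ schreier α (Order.succ γ) :=
  mem_schreier_succ_of_monotoneOn hn c h.monotoneOn hc h.le h.fiber_mem

theorem IsGrouping.exists_succ (hα : IsApproximatingSystem α) (hγ : Order.succ γ < ω₁)
    {κ : Type*} (J : Finset κ) {w n : κ → ℕ+} (hn : ∀ j, n j ≤ w j) {h : ℕ+ → ℕ}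
    (hh : IsGrouping (schreier α γ) P (fun p => ∑ j ∈ J.filter (w · ≤ p), (n j : ℕ)) h) :
    ∃ g, IsGrouping (schreier α (Order.succ γ)) P (fun p => (J.filter (w · ≤ p)).card) g := by
  classical
  have hempty := empty_mem_schreier hα hγ
  induction J using Finset.induction_on_max_value w generalizing P with
  | empty =>
    refine ⟨_, .of_mem (P := P) ?_ hempty fun p hp => ?_⟩
    · convert hempty
      refine Finset.eq_empty_of_forall_notMem fun p hp => ?_
      have := (hh.one_le p hp).trans (hh.le p hp)
      simp at this
    · exact (hh.one_le p hp).trans (hh.le p hp)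
  | insert a s ha hmax ih =>
    have hsub : ∀ E ∈ schreier α γ, ∀ F ⊆ E, F ∈ schreier α γ := fun _ hE _ hF =>
      schreier_subset hα ((Order.lt_succ γ).trans hγ) hE hF
    set N := ∑ j ∈ s, (n j : ℕ)
    have hfilter_of_le {p} (hp : w a ≤ p) : s.filter (w · ≤ p) = s :=
      Finset.filter_true_of_mem fun j hj => (hmax j hj).trans hp
    have hle {p} (hp : p ∈ P) : (w a ≤ p ∧ h p ≤ N + n a) ∨
        h p ≤ ∑ j ∈ s.filter (w · ≤ p), (n j : ℕ) := by
      have hp' := hh.le p hp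
      by_cases hw : w a ≤ p
      · rw [Finset.filter_insert, if_pos hw, hfilter_of_le hw, Finset.sum_insert ha,
          add_comm] at hp'
        exact Or.inl ⟨hw, hp'⟩
      · rw [Finset.filter_insert, if_neg hw] at hp'
        exact Or.inr hp'
    obtain ⟨g, hg⟩ := ih (P := P.filter (h · ≤ N)) <|
      hh.mono hsub (Finset.filter_subset _ _) fun p hp => by
        obtain ⟨hp, hpN⟩ := Finset.mem_filter.1 hp
        refine (hle hp).elim (fun hw => ?_) id
        rwa [hfilter_of_le hw.1]
    -- The last `n a ≤ w a` groups start at `w a` or later, so they form one member of `𝓢_(γ + 1)`.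
    have hlast : ∀ p ∈ P.filter (N < h ·), w a ≤ p ∧ h p ≤ N + n a := fun p hp => by
      obtain ⟨hp, hNp⟩ := Finset.mem_filter.1 hp
      exact (hle hp).resolve_right
        (hNp.trans_le' (Finset.sum_le_sum_of_subset (Finset.filter_subset _ _))).not_ge
    have hR : P.filter (N < h ·) ∈ schreier α (Order.succ γ) :=
      (hh.mono hsub (Finset.filter_subset _ _) fun p hp => (hlast p hp).2).mem_schreier_succ
        (fun p hp => (hn a).trans (hlast p hp).1) fun p hp => (Finset.mem_filter.1 hp).2
    rw [← Finset.filter_union_filter_not_eq (h · ≤ N) P]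
    simp only [not_le]
    refine hg.exists_append ha hmax (fun p hp q hq => ?_) hR hempty fun p hp => (hlast p hp).1
    simp only [Finset.coe_filter, Set.mem_ofPred_eq] at hp hq
    exact hh.monotoneOn.reflect_lt hp.1 hq.1 (hp.2.trans_lt hq.2)

theorem HasGrouping.schreier_succ (hα : IsApproximatingSystem α) (hγ : Order.succ γ < ω₁)
    (h : HasGrouping (schreier α γ)) : HasGrouping (schreier α (Order.succ γ)) := by
  rintro κ J v P ⟨A, hA, hv, hP⟩
  choose n E hE hn _ hAE using fun j => schreier_succ_iff.1 (hA j)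
  let w : κ → ℕ+ := fun j => max (v j) (n j)
  have hw (x : Σ j, Fin (n j)) : ∀ p ∈ E x.1 x.2, w x.1 ≤ p := fun p hp => by
    have hpA : p ∈ A x.1 := by
      rw [hAE]
      exact Finset.mem_biUnion.2 ⟨x.2, Finset.mem_univ _, hp⟩
    exact max_le (hv _ p hpA) (hn _ p hpA)
  obtain ⟨g, hg⟩ := h (J.sigma fun j => (Finset.univ : Finset (Fin (n j)))) (fun x => w x.1) P
    ⟨fun x => E x.1 x.2, fun x => hE _ _, hw, fun p hp => by
      obtain ⟨j, hj, hpj⟩ := Finset.mem_biUnion.1 (hP hp)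
      rw [hAE j] at hpj
      obtain ⟨i, -, hi⟩ := Finset.mem_biUnion.1 hpj
      exact Finset.mem_biUnion.2 ⟨⟨j, i⟩, Finset.mem_sigma.2 ⟨hj, Finset.mem_univ _⟩, hi⟩⟩
  have hcard (p) : ((J.sigma fun j => (Finset.univ : Finset (Fin (n j)))).filter
      (w ·.1 ≤ p)).card = ∑ j ∈ J.filter (w · ≤ p), (n j : ℕ) := by
    have : (J.sigma fun j => (Finset.univ : Finset (Fin (n j)))).filter (w ·.1 ≤ p) =
        (J.filter (w · ≤ p)).sigma fun j => Finset.univ := by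
      ext x
      simp
    rw [this, Finset.card_sigma]
    simp
  simp only [hcard] at hg
  obtain ⟨g', hg'⟩ := hg.exists_succ hα hγ J fun j => le_max_right (v j) (n j)
  exact ⟨g', hg'.monotoneOn, hg'.one_le, fun p hp => (hg'.le p hp).trans <| Finset.card_le_card <|
    Finset.monotone_filter_right _ fun j _ hj => (le_max_left _ _).trans hj, hg'.fiber_mem⟩

end Grouping

section GroupingLimit

variable {α : Ordinal.{0} → ℕ+ → Ordinal.{0}} {ξ : Ordinal.{0}} {A B P : Finset ℕ+} {m : ℕ+}

theorem union_mem_schreier_limit (hα : IsApproximatingSystem α) (hξ : ξ < ω₁)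
    (hl : Order.IsSuccLimit ξ) (hm : HasGrouping (schreier α (α ξ m)))
    (hA : A ∈ schreier α (α ξ m)) (hB : B ∈ schreier α (α ξ m)) (h : ∀ p ∈ A ∪ B, m < p) :
    A ∪ B ∈ schreier α ξ := by
  obtain ⟨g, hg⟩ := hm (κ := Bool) Finset.univ (fun _ => 1) (A ∪ B)
    ⟨fun b => cond b A B, Bool.forall_bool.2 ⟨hB, hA⟩, fun _ _ _ => one_le, by simp⟩
  have hg2 : ∀ p ∈ A ∪ B, g p = 1 ∨ g p = 2 := fun p hp => by
    have h1 := hg.one_le p hp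
    have h2 : g p ≤ 2 := (hg.le p hp).trans (Finset.card_le_univ _)
    omega
  have hunion := hα.union_mem ξ hξ hl m _ _ (hg.fiber_mem 1) (hg.fiber_mem 2)
    (fun a ha b hb => by
      obtain rfl : a = 1 := ha
      exact one_le.trans_lt (h b (Finset.mem_filter.1 hb).1))
    (fun a ha b hb => by
      simp only [Finset.coe_filter, Set.mem_ofPred_eq] at ha hb
      exact hg.monotoneOn.reflect_lt ha.1 hb.1 (by omega))
  rw [← Finset.filter_or, Finset.filter_true_of_mem hg2] at hunion
  exact (schreier_limit_iff hl).2 ⟨m + 1, hunion, fun p hp => PNat.add_one_le_iff.2 (h p hp)⟩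

theorem filter_lt_mem_schreier_approx (hα : IsApproximatingSystem α) (hξ : ξ < ω₁)
    (hl : Order.IsSuccLimit ξ) (hA : A ∈ schreier α ξ) (h1 : 1 ∉ A) (hm : ∃ p ∈ A, p ≤ m) :
    A.filter (m < ·) ∈ schreier α (α ξ m) := by
  obtain ⟨n, hn, hnA⟩ := (schreier_limit_iff hl).1 hA
  obtain ⟨p, hp, hpm⟩ := hm
  exact schreier_subset hα ((hα.lt ξ hξ hl m).trans hξ)
    (schreier_limit_mono hα hξ hl h1 ((hnA p hp).trans hpm) hn) (Finset.filter_subset _ _)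

theorem filter_le_mem_schreier (hα : IsApproximatingSystem α) (hξ : ξ < ω₁)
    (hA : A ∈ schreier α ξ) (hP : P.filter (· < m) ⊆ A) {z : ℕ+} (hz : z ∈ A) (hmz : m ≤ z) :
    P.filter (· ≤ m) ∈ schreier α ξ := by
  have hlt {p} (hp : p ∈ P.filter (· ≤ m)) (hpm : p < m) : p ∈ A :=
    hP (Finset.mem_filter.2 ⟨(Finset.mem_filter.1 hp).1, hpm⟩)
  refine mem_schreier_of_spread hα hξ hA (fun p => if p < m then p else z)
    (fun p _ q hq hpq => ?_) (fun p hp => ?_) fun p _ q hq hpq => ?_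
  · have hpm : p < m := hpq.trans_le (Finset.mem_filter.1 hq).2
    simp only [hpm, if_true]
    split_ifs
    exacts [hpq, hpm.trans_le hmz]
  · split_ifs with hpm
    exacts [hlt hp hpm, hz]
  · rw [if_pos (hpq.trans_le (Finset.mem_filter.1 hq).2)]

theorem filter_lt_union_mem_schreier_limit (hα : IsApproximatingSystem α) (hξ : ξ < ω₁)
    (hl : Order.IsSuccLimit ξ) (hm : HasGrouping (schreier α (α ξ m))) (hA : A ∈ schreier α ξ)
    (hB : B ∈ schreier α ξ) (h1A : 1 ∉ A) (h1B : 1 ∉ B) (hmA : ∃ p ∈ A, p ≤ m)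
    (hmB : ∃ p ∈ B, p ≤ m) : A.filter (m < ·) ∪ B.filter (m < ·) ∈ schreier α ξ := by
  refine union_mem_schreier_limit hα hξ hl hm (filter_lt_mem_schreier_approx hα hξ hl hA h1A hmA)
    (filter_lt_mem_schreier_approx hα hξ hl hB h1B hmB) fun p hp => ?_
  rw [← Finset.filter_union] at hp
  exact (Finset.mem_filter.1 hp).2

theorem IsCovered.merge {𝓕 : Set (Finset ℕ+)} {κ : Type*} [DecidableEq κ] {J : Finset κ}
    {v : κ → ℕ+} {A : κ → Finset ℕ+} (hA : ∀ j, A j ∈ 𝓕) (hv : ∀ j, ∀ n ∈ A j, v j ≤ n)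
    (hP : P ⊆ J.biUnion A) {i j : κ} (hj : j ∈ J.erase i) (hjm : v j ≤ m)
    (hij : (A i ∩ P).filter (m < ·) ∪ (A j ∩ P).filter (m < ·) ∈ 𝓕) :
    IsCovered 𝓕 (J.erase i) v (P.filter (¬ · ≤ m)) := by
  refine ⟨Function.update A j _, (Function.forall_update_iff A fun _ E => E ∈ 𝓕).2
    ⟨hij, fun l _ => hA l⟩, (Function.forall_update_iff A fun l E => ∀ n ∈ E, v l ≤ n).2
    ⟨fun p hp => ?_, fun l _ => hv l⟩, fun p hp => ?_⟩
  · rw [← Finset.filter_union] at hp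
    exact hjm.trans (Finset.mem_filter.1 hp).2.le
  · obtain ⟨hpP, hmp⟩ := Finset.mem_filter.1 hp
    obtain ⟨l, hl, hpl⟩ := Finset.mem_biUnion.1 (hP hpP)
    by_cases hlij : l = i ∨ l = j
    · refine Finset.mem_biUnion.2 ⟨j, hj, ?_⟩
      rw [Function.update_self, ← Finset.filter_union]
      refine Finset.mem_filter.2 ⟨Finset.mem_union.2 (hlij.imp ?_ ?_), not_le.1 hmp⟩ <;>
      · rintro rfl
        exact Finset.mem_inter.2 ⟨hpl, hpP⟩
    · obtain ⟨hli, hlj⟩ := not_or.1 hlij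
      refine Finset.mem_biUnion.2 ⟨l, Finset.mem_erase.2 ⟨hli, hl⟩, ?_⟩
      rwa [Function.update_of_ne hlj]

/- Let `m` be the first point of `P` outside the set `A i` that contains `min P`, say `m ∈ A j`. The
points of `P` before `m` lie in `A i`, and `m` can join them in place of a later point of `A i`.
Beyond `m`, the remainders of `A i` and `A j` merge into a single member of `𝓢_ξ`, as both sets
meet `[1, m]`; so one index is used up. -/
theorem IsCovered.exists_first_group (hα : IsApproximatingSystem α) (hξ : ξ < ω₁)
    (hl : Order.IsSuccLimit ξ) (hgr : ∀ m, HasGrouping (schreier α (α ξ m))) {κ : Type*}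
    [DecidableEq κ] {J : Finset κ} {v : κ → ℕ+} (hP : IsCovered (schreier α ξ) J v P)
    (hne : P.Nonempty) :
    ∃ j ∈ J, (∀ p ∈ P, v j ≤ p) ∧ ∃ F R, F ∪ R = P ∧ SetLT (F : Set ℕ+) R ∧
      F ∈ schreier α ξ ∧ IsCovered (schreier α ξ) (J.erase j) v R := by
  obtain ⟨A, hA, hv, hPA⟩ := hP
  obtain ⟨i, hi, hpi⟩ := Finset.mem_biUnion.1 (hPA (P.min'_mem hne))
  refine ⟨i, hi, fun p hp => (hv i _ hpi).trans (P.min'_le p hp), ?_⟩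
  set U := (J.erase i).biUnion A with hU
  have hPU : ∀ p ∈ P, p ∉ U → p ∈ A i := fun p hp hpU => by
    obtain ⟨j, hj, hpj⟩ := Finset.mem_biUnion.1 (hPA hp)
    by_contra hpi
    exact hpU (Finset.mem_biUnion.2 ⟨j, Finset.mem_erase.2 ⟨fun h => hpi (h ▸ hpj), hj⟩, hpj⟩)
  rcases (P ∩ U).eq_empty_or_nonempty with hempty | hPUne
  · refine ⟨P, ∅, Finset.union_empty P, by simp [SetLT], schreier_subset hα hξ (hA i) fun p hp =>
      hPU p hp fun hpU => ?_, A, hA, hv, Finset.empty_subset _⟩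
    exact Finset.notMem_empty p (hempty ▸ Finset.mem_inter.2 ⟨hp, hpU⟩)
  set m := (P ∩ U).min' hPUne
  obtain ⟨hmP, hmU⟩ := Finset.mem_inter.1 ((P ∩ U).min'_mem hPUne)
  have hbelow : P.filter (· < m) ⊆ A i := fun p hp => by
    obtain ⟨hpP, hlt⟩ := Finset.mem_filter.1 hp
    exact hPU p hpP fun hpU => hlt.not_ge ((P ∩ U).min'_le p (Finset.mem_inter.2 ⟨hpP, hpU⟩))
  by_cases hR : P.filter (¬ · < m) ⊆ U
  · exact ⟨_, _, Finset.filter_union_filter_not_eq (· < m) P, fun a ha b hb =>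
      (Finset.mem_filter.1 ha).2.trans_le (not_lt.1 (Finset.mem_filter.1 hb).2),
      schreier_subset hα hξ (hA i) hbelow, A, hA, hv, hR⟩
  obtain ⟨z, hz, hzU⟩ := Finset.not_subset.1 hR
  obtain ⟨hzP, hmz⟩ := Finset.mem_filter.1 hz
  have h1 : 1 ∉ P := fun h1 => hzU <| by
    rw [le_antisymm (P.min'_le 1 h1) one_le] at hpi
    have hz1 := eq_one_of_one_mem_schreier (hA i) hpi z (hPU z hzP hzU)
    rwa [← le_antisymm (not_lt.1 hmz) (hz1 ▸ one_le)]
  obtain ⟨j, hj, hmj⟩ := Finset.mem_biUnion.1 hmU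
  have hinter (l) : A l ∩ P ∈ schreier α ξ ∧ 1 ∉ A l ∩ P :=
    ⟨schreier_subset hα hξ (hA l) Finset.inter_subset_left, fun h => h1 (Finset.mem_inter.1 h).2⟩
  refine ⟨_, _, Finset.filter_union_filter_not_eq (· ≤ m) P, fun a ha b hb =>
    (Finset.mem_filter.1 ha).2.trans_lt (not_le.1 (Finset.mem_filter.1 hb).2),
    filter_le_mem_schreier hα hξ (hA i) hbelow (hPU z hzP hzU) (not_lt.1 hmz),
    .merge hA hv hPA hj (hv j m hmj) ?_⟩
  exact filter_lt_union_mem_schreier_limit hα hξ hl (hgr m) (hinter i).1 (hinter j).1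
    (hinter i).2 (hinter j).2 ⟨_, Finset.mem_inter.2 ⟨hpi, P.min'_mem hne⟩, P.min'_le m hmP⟩
    ⟨m, Finset.mem_inter.2 ⟨hmj, hmP⟩, le_rfl⟩

theorem HasGrouping.schreier_limit (hα : IsApproximatingSystem α) (hξ : ξ < ω₁)
    (hl : Order.IsSuccLimit ξ) (hgr : ∀ m, HasGrouping (schreier α (α ξ m))) :
    HasGrouping (schreier α ξ) := by
  classical
  intro κ J v P hP
  have hempty := empty_mem_schreier hα hξ
  induction hc : J.card using Nat.strong_induction_on generalizing J P with
  | _ c ih =>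
  rcases P.eq_empty_or_nonempty with rfl | hne
  · exact ⟨_, .of_mem hempty hempty (by simp)⟩
  obtain ⟨j, hj, hjP, F, R, rfl, hFR, hF, hR⟩ := hP.exists_first_group hα hξ hl hgr hne
  obtain ⟨g, hg⟩ := ih _ (hc ▸ Finset.card_erase_lt_of_mem hj) _ _ hR rfl
  have hjmem (p) (hp : p ∈ F ∪ R) : j ∈ J.filter (v · ≤ p) :=
    Finset.mem_filter.2 ⟨hj, hjP p hp⟩
  refine ⟨_, (IsGrouping.of_mem (b := fun _ => 1) hF hempty fun _ _ => le_rfl).concat hFR hg 1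
    (fun _ _ => le_rfl) (fun p hp => ?_) fun p hp => ?_⟩
  · exact Finset.card_pos.2 ⟨j, hjmem p (Finset.mem_union_left _ hp)⟩
  · rw [Finset.filter_erase, add_comm,
      Finset.card_erase_add_one (hjmem p (Finset.mem_union_right _ hp))]

theorem hasGrouping_schreier (hα : IsApproximatingSystem α) (hξ : ξ < ω₁) :
    HasGrouping (schreier α ξ) := by
  induction ξ using WellFoundedLT.induction with
  | _ ξ ih =>
  rcases Ordinal.zero_or_succ_or_isSuccLimit ξ with rfl | ⟨γ, rfl⟩ | hl
  · exact hasGrouping_schreier_zero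
  · exact HasGrouping.schreier_succ hα hξ (ih γ (Order.lt_succ γ) ((Order.lt_succ γ).trans hξ))
  · exact HasGrouping.schreier_limit hα hξ hl fun m =>
      ih _ (hα.lt ξ hξ hl m) ((hα.lt ξ hξ hl m).trans hξ)

end GroupingLimit

section Blocking

variable {α : Ordinal.{0} → ℕ+ → Ordinal.{0}} {ξ : Ordinal.{0}} {𝓕 : Set (Finset ℕ+)} {θ : ℝ}
  {w w' : ℕ+ → ℝ} {G H J P : Finset ℕ+} {u : ℕ+ → ℕ}

/-- The functional `x ↦ ∑ n ∈ G, w n * |x n|` is bounded by the Tsirelson norm. -/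
def Dominated (𝓕 : Set (Finset ℕ+)) (θ : ℝ) (w : ℕ+ → ℝ) (G : Finset ℕ+) : Prop :=
  ∀ x : ℕ+ →₀ ℝ, ∑ n ∈ G, w n * |x n| ≤ tsirelsonNorm 𝓕 θ x

theorem Dominated.mono (h : Dominated 𝓕 θ w H) (hw : ∀ n, 0 ≤ w n) (hGH : G ⊆ H) :
    Dominated 𝓕 θ w G := fun x =>
  (Finset.sum_le_sum_of_subset_of_nonneg hGH fun n _ _ =>
    mul_nonneg (hw n) (abs_nonneg _)).trans (h x)

theorem Dominated.congr (h : Dominated 𝓕 θ w G) (hw : ∀ n ∈ G, w' n = w n) :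
    Dominated 𝓕 θ w' G := fun x =>
  (Finset.sum_congr rfl fun n hn => by rw [hw n hn]).trans_le (h x)

theorem dominated_empty : Dominated 𝓕 θ w ∅ := fun x => tsirelsonNorm_nonneg x

theorem dominated_singleton (hθ : θ ≤ 1) {n : ℕ+} (hw : w n = 1) : Dominated 𝓕 θ w {n} :=
  fun x => by simpa [hw] using abs_apply_le_tsirelsonNorm hθ x n

/-- The least elements of the nonempty fibres of `u` in `G`. -/
def blockMins (u : ℕ+ → ℕ) (G : Finset ℕ+) : Finset ℕ+ :=
  G.filter fun n => ∀ m ∈ G, m < n → u m ≠ u n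

theorem mem_blockMins_iff {n : ℕ+} : n ∈ blockMins u G ↔ IsLeast {m ∈ G | u m = u n} n := by
  simp only [blockMins, Finset.mem_filter, IsLeast, lowerBounds, Set.mem_ofPred_eq, and_true]
  refine and_congr_right fun _ => ⟨fun h m hm => ?_, fun h m hm hlt heq => (h ⟨hm, heq⟩).not_gt hlt⟩
  exact not_lt.1 fun hlt => h m hm.1 hlt hm.2

theorem mul_sum_fiber_le_tsirelsonNorm (hθ : 0 < θ) (hθ' : θ ≤ 1) (hu : MonotoneOn u G)
    (hG : blockMins u G ∈ 𝓕) (x : ℕ+ →₀ ℝ) :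
    θ * ∑ i ∈ G.image u, tsirelsonNorm 𝓕 θ (proj (G.filter (u · = i)) x) ≤
      tsirelsonNorm 𝓕 θ x := by
  let e := (G.image u).orderEmbOfFin rfl
  let E (i : Fin (G.image u).card) : Finset ℕ+ := G.filter (u · = e i)
  have hne (i) : (E i).Nonempty := by
    obtain ⟨n, hn, hni⟩ := Finset.mem_image.1 ((G.image u).orderEmbOfFin_mem rfl i)
    exact ⟨n, Finset.mem_filter.2 ⟨hn, hni⟩⟩
  have hleast (i) : IsLeast (E i : Set ℕ+) ((E i).min' (hne i)) := (E i).isLeast_min' _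
  have hmins : Finset.univ.image (fun i => (E i).min' (hne i)) = blockMins u G := by
    ext n
    simp only [Finset.mem_image, Finset.mem_univ, true_and, mem_blockMins_iff]
    refine ⟨?_, fun hn => ?_⟩
    · rintro ⟨i, rfl⟩
      have hi : u ((E i).min' (hne i)) = e i := (Finset.mem_filter.1 (hleast i).1).2
      simpa [E, hi] using hleast i
    · obtain ⟨i, hi⟩ : ∃ i, e i = u n := by
        rw [← Set.mem_range, Finset.range_orderEmbOfFin]
        exact Finset.mem_coe.2 (Finset.mem_image_of_mem u hn.1.1)
      refine ⟨i, (hleast i).unique ?_⟩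
      simpa [E, hi] using hn
  have hadm : IsAdmissible 𝓕 fun i => (E i : Set ℕ+) := by
    refine ⟨fun i j hij a ha b hb => ?_, _, hleast, hmins ▸ hG⟩
    obtain ⟨ha, hai⟩ := Finset.mem_filter.1 ha
    obtain ⟨hb, hbj⟩ := Finset.mem_filter.1 hb
    exact hu.reflect_lt ha hb (by rw [hai, hbj]; exact e.strictMono hij)
  rw [← Finset.map_orderEmbOfFin_univ (G.image u) rfl, Finset.sum_map]
  exact mul_le_tsirelsonNorm hθ hθ' x _ ⟨_, E, hadm, rfl⟩

theorem Dominated.combine (hθ : 0 < θ) (hθ' : θ ≤ 1) (hu : MonotoneOn u G)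
    (hG : blockMins u G ∈ 𝓕) (h : ∀ i, Dominated 𝓕 θ w (G.filter (u · = i))) :
    Dominated 𝓕 θ (fun n => θ * w n) G := fun x => by
  refine le_trans ?_ (mul_sum_fiber_le_tsirelsonNorm hθ hθ' hu hG x)
  simp only [mul_assoc]
  rw [← Finset.mul_sum, ← Finset.sum_fiberwise_of_maps_to fun n => Finset.mem_image_of_mem u]
  refine mul_le_mul_of_nonneg_left (Finset.sum_le_sum fun i _ => ?_) hθ.le
  refine le_trans (Finset.sum_le_sum fun n hn => ?_) (h i (proj (G.filter (u · = i)) x))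
  rw [proj, Finsupp.filter_apply_pos _ _ hn]

/-- `u` cuts `G` into successive blocks `{n ∈ G | u n = i}`, `i ≥ 1`, on each of which the
functional with the coefficients `w` is bounded by the Tsirelson norm; at most as many blocks as
there are elements of `P` up to `n` begin up to `n`. -/
structure IsBlocking (𝓕 : Set (Finset ℕ+)) (θ : ℝ) (w : ℕ+ → ℝ) (G P : Finset ℕ+)
    (u : ℕ+ → ℕ) : Prop where
  monotone : Monotone u
  le_countLE : ∀ n, u n ≤ countLE P n
  one_le : ∀ n ∈ G, 1 ≤ u n
  dominated : ∀ i, Dominated 𝓕 θ w (G.filter (u · = i))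

theorem IsBlocking.exists_parent (hα : IsApproximatingSystem α) (hξ : ξ < ω₁) (hθ : 0 < θ)
    (hθ' : θ ≤ 1) (hw : ∀ n, 0 ≤ w n) (h : IsBlocking (schreier α ξ) θ w G P u)
    (hP : IsCovered (schreier α ξ) J id P) :
    ∃ β, IsBlocking (schreier α ξ) θ (fun n => θ * w n) G J β := by
  obtain ⟨g, hg⟩ := hasGrouping_schreier hα hξ J id P hP
  have hexists (n) (hn : 1 ≤ u n) : ∃ p ∈ P, countLE P p = u n :=
    exists_mem_countLE_eq hn ((h.le_countLE n).trans (countLE_le_card P n))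
  choose! p hpP hp using hexists
  have hp_mono {a b} (ha : 1 ≤ u a) (hb : 1 ≤ u b) (hab : u a ≤ u b) : p a ≤ p b :=
    le_of_countLE_le (hpP a ha) (by rwa [hp a ha, hp b hb])
  have hp_le {n} (hn : 1 ≤ u n) : p n ≤ n :=
    le_of_countLE_le (hpP n hn) (by rw [hp n hn]; exact h.le_countLE n)
  let β (n : ℕ+) : ℕ := if 1 ≤ u n then g (p n) else 0
  have hβ {n} (hn : 1 ≤ u n) : β n = g (p n) := if_pos hn
  refine ⟨β, fun a b hab => ?_, fun n => ?_, fun n hn => ?_, fun i => ?_⟩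
  · have hu := h.monotone hab
    by_cases ha : 1 ≤ u a
    · rw [hβ ha, hβ (ha.trans hu)]
      exact hg.monotoneOn (hpP a ha) (hpP b (ha.trans hu)) (hp_mono ha (ha.trans hu) hu)
    · exact (if_neg ha).trans_le (Nat.zero_le _)
  · by_cases hn : 1 ≤ u n
    · rw [hβ hn]
      exact (hg.le _ (hpP n hn)).trans (countLE_monotone J (hp_le hn))
    · exact (if_neg hn).trans_le (Nat.zero_le _)
  · rw [hβ (h.one_le n hn)]
    exact hg.one_le _ (hpP n (h.one_le n hn))
  · refine .combine hθ hθ' (h.monotone.monotoneOn _) ?_ fun j =>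
      (h.dominated j).mono hw (Finset.filter_subset_filter _ (Finset.filter_subset _ _))
    have hmem {n} (hn : n ∈ blockMins u (G.filter (β · = i))) : 1 ≤ u n ∧ β n = i :=
      have hn := Finset.mem_filter.1 (Finset.mem_filter.1 hn).1
      ⟨h.one_le n hn.1, hn.2⟩
    refine mem_schreier_of_spread hα hξ (hg.fiber_mem i) p (fun a ha b hb hab => ?_)
      (fun n hn => ?_) fun n hn _ _ _ => hp_le (hmem hn).1
    · have hlt : u a < u b := (h.monotone hab.le).lt_of_ne <|
        (Finset.mem_filter.1 hb).2 a (Finset.mem_filter.1 ha).1 hab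
      refine (countLE_monotone P).reflect_lt ?_
      rwa [hp a (hmem ha).1, hp b (hmem hb).1]
    · exact Finset.mem_filter.2 ⟨hpP n (hmem hn).1, by rw [← hβ (hmem hn).1, (hmem hn).2]⟩

end Blocking

/-- The tree of a functional `x ↦ ∑ θ ^ depth n * |x n|` in the norming set of the modified
Tsirelson space, supported in `X`. Its nodes are subsets of `X`, those of depth `e` being pairwise
disjoint; a leaf is a singleton `{n}`, `n ∈ leaves`, and an inner node of depth `e` is recorded by
an element of `nodes e` not exceeding the minimum of any of its children, which form an
`𝓕`-allowable family. -/
structure LevelTree (𝓕 : Set (Finset ℕ+)) (X : Finset ℕ+) where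
  leaves : Finset ℕ+
  depth : ℕ+ → ℕ
  nodes : ℕ → Finset ℕ+
  leaves_subset : leaves ⊆ X
  nodes_subset : ∀ e, nodes e ⊆ X
  notMem_nodes : ∀ n ∈ leaves, n ∉ nodes (depth n)
  card_root_le : (nodes 0 ∪ leaves.filter (depth · = 0)).card ≤ 1
  children : ∀ e, IsCovered 𝓕 (nodes e) id (nodes (e + 1) ∪ leaves.filter (depth · = e + 1))

section DominatedLeaves

variable {α : Ordinal.{0} → ℕ+ → Ordinal.{0}} {ξ : Ordinal.{0}} {𝓕 : Set (Finset ℕ+)} {θ : ℝ}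
  {X K H : Finset ℕ+} {β δ : ℕ+ → ℕ} {e : ℕ}

theorem Dominated.of_depth (hθ : 0 < θ) (hθ' : θ ≤ 1) (hle : ∀ n ∈ H, e ≤ δ n)
    (hsep : ∀ m ∈ H, ∀ n ∈ H, δ m = e → m = n)
    (h : Dominated 𝓕 θ (fun n => θ * θ ^ (δ n - (e + 1))) (H.filter (e < δ ·))) :
    Dominated 𝓕 θ (fun n => θ ^ (δ n - e)) H := by
  by_cases hleaf : ∃ m ∈ H, δ m = e
  · obtain ⟨m, hm, hme⟩ := hleaf
    exact (dominated_singleton hθ' (by simp [hme])).mono (fun n => by positivity)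
      fun n hn => Finset.mem_singleton.2 (hsep m hm n hn hme).symm
  · push Not at hleaf
    have hlt (n) (hn : n ∈ H) : e < δ n := (hle n hn).lt_of_ne' (hleaf n hn)
    rw [Finset.filter_true_of_mem hlt] at h
    refine h.congr fun n hn => ?_
    rw [← pow_succ', Nat.sub_add_eq, Nat.sub_add_cancel (Nat.sub_pos_of_lt (hlt n hn))]

theorem card_image_cut_le_three {S : Finset ℕ+} (hS : S.card ≤ 1) (G : Finset ℕ+) :
    (G.image (cut S)).card ≤ 3 := by
  have hsub : G.image (cut S) ⊆ Finset.range 3 := Finset.image_subset_iff.2 fun n _ => by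
    have h1 := cut_le_two_mul_countLE S n
    have h2 := countLE_le_card S n
    exact Finset.mem_range.2 (by omega)
  exact (Finset.card_le_card hsub).trans_eq (Finset.card_range 3)

theorem card_blockMins_le (u : ℕ+ → ℕ) (G : Finset ℕ+) :
    (blockMins u G).card ≤ (G.image u).card := by
  refine Finset.card_le_card_of_injOn u (fun n hn => Finset.mem_image_of_mem u
    (Finset.mem_filter.1 hn).1) fun m hm n hn hmn => ?_
  have hm := mem_blockMins_iff.1 hm
  exact hm.unique (hmn ▸ mem_blockMins_iff.1 hn)

/-- A level without other leaves than `ℓ` contributes at most three blocks, namely those before,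
at and after `ℓ`. -/
theorem dominated_of_injOn_depth (hα : IsApproximatingSystem α) (hξ : ξ < ω₁) (hξ0 : ξ ≠ 0)
    (hθ : 0 < θ) (hθ' : θ ≤ 1) (hK : ∀ n ∈ K, 3 ≤ n) (hδ : Set.InjOn δ K)
    (hδ0 : ∀ n ∈ K, 0 < δ n) : Dominated (schreier α ξ) θ (fun n => θ ^ δ n) K := by
  have hdeeper {e} (he : e ≤ K.sup δ) :
      Dominated (schreier α ξ) θ (fun n => θ * θ ^ (δ n - (e + 1))) (K.filter (e < δ ·)) := by
    induction he using Nat.decreasingInduction with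
    | self =>
      rw [Finset.filter_false_of_mem fun n hn => (Finset.le_sup (f := δ) hn).not_gt]
      exact dominated_empty
    | of_succ e _ ih =>
      set S := K.filter (δ · = e + 1)
      have hS : S.card ≤ 1 := Finset.card_le_one.2 fun m hm n hn => by
        obtain ⟨hm, hme⟩ := Finset.mem_filter.1 hm
        obtain ⟨hn, hne⟩ := Finset.mem_filter.1 hn
        exact hδ hm hn (hme.trans hne.symm)
      refine .combine hθ hθ' ((cut_monotone S).monotoneOn _) ?_ fun i =>
        .of_depth hθ hθ' (fun n hn => ?_) (fun m hm n hn hme => ?_)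
          (ih.mono (fun n => by positivity) ?_)
      · exact mem_schreier_of_card_le (n := 3) hα hξ hξ0
          ((card_blockMins_le _ _).trans (card_image_cut_le_three hS _)) fun n hn =>
            hK n (Finset.mem_filter.1 (Finset.mem_filter.1 hn).1).1
      · exact (Finset.mem_filter.1 (Finset.mem_filter.1 hn).1).2
      · obtain ⟨hmG, rfl⟩ := Finset.mem_filter.1 hm
        have hmS : m ∈ S := Finset.mem_filter.2 ⟨(Finset.mem_filter.1 hmG).1, hme⟩
        exact (eq_of_cut_eq hmS (Finset.mem_filter.1 hn).2.symm)
      · exact Finset.filter_subset_filter _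
          ((Finset.filter_subset _ _).trans (Finset.filter_subset _ _))
  exact .of_depth hθ hθ' (fun n _ => Nat.zero_le _)
    (fun m hm n _ hm0 => absurd hm0 (hδ0 m hm).ne') (hdeeper (Nat.zero_le _))

end DominatedLeaves

namespace LevelTree

variable {α : Ordinal.{0} → ℕ+ → Ordinal.{0}} {ξ : Ordinal.{0}} {𝓕 : Set (Finset ℕ+)} {θ : ℝ}
  {X K : Finset ℕ+} {β : ℕ+ → ℕ} {e : ℕ}

/-- The leaves of depth `e`. -/
def leavesAt (T : LevelTree 𝓕 X) (e : ℕ) : Finset ℕ+ := T.leaves.filter (T.depth · = e)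

/-- The tree `T` as a functional, evaluated at `|x|`. -/
noncomputable def eval (T : LevelTree 𝓕 X) (θ : ℝ) (x : ℕ+ →₀ ℝ) : ℝ :=
  ∑ n ∈ T.leaves, θ ^ T.depth n * |x n|

/-- The leaves in `K` can be separated on every level: blocks of the deeper leaves, whose number
is bounded by the number of inner nodes, can be refined such that the leaves in `K` of depth `e`
become blocks of their own, at the cost of at most one further block per leaf of depth `e`. -/
def IsSeparable (T : LevelTree 𝓕 X) (K : Finset ℕ+) : Prop :=
  ∀ e β, Monotone β → (∀ n, β n ≤ countLE (T.nodes e) n) →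
    (∀ n ∈ K, e < T.depth n → 1 ≤ β n) →
    ∃ κ : ℕ+ → ℕ, Monotone κ ∧ (∀ n, κ n ≤ countLE (T.leavesAt e) n) ∧
      (∀ n ∈ K, T.depth n = e → 1 ≤ κ n) ∧
      ∀ m ∈ K, ∀ n ∈ K, e ≤ T.depth m → e ≤ T.depth n → m < n →
        T.depth m = e ∨ T.depth n = e → β m + κ m < β n + κ n

theorem disjoint_nodes_leavesAt (T : LevelTree 𝓕 X) (e : ℕ) :
    Disjoint (T.nodes e) (T.leavesAt e) := Finset.disjoint_right.2 fun n hn => by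
  obtain ⟨hnL, rfl⟩ : n ∈ T.leaves ∧ T.depth n = e := Finset.mem_filter.1 hn
  exact T.notMem_nodes n hnL

variable {T : LevelTree 𝓕 X}

theorem IsSeparable.exists_blocking (hK : T.IsSeparable K) (hθ : 0 < θ) (hθ' : θ ≤ 1)
    (h : IsBlocking 𝓕 θ (fun n => θ * θ ^ (T.depth n - (e + 1))) (K.filter (e < T.depth ·))
      (T.nodes e) β) :
    ∃ u, IsBlocking 𝓕 θ (fun n => θ ^ (T.depth n - e)) (K.filter (e ≤ T.depth ·))
      (T.nodes e ∪ T.leavesAt e) u := by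
  obtain ⟨κ, hκ, hκle, hκpos, hsep⟩ := hK e β h.monotone h.le_countLE fun n hn hlt =>
    h.one_le n (Finset.mem_filter.2 ⟨hn, hlt⟩)
  refine ⟨fun n => β n + κ n, h.monotone.add hκ, fun n => ?_, fun n hn => ?_, fun i => ?_⟩
  · rw [countLE_union (T.disjoint_nodes_leavesAt e)]
    exact add_le_add (h.le_countLE n) (hκle n)
  · obtain ⟨hn, hle⟩ := Finset.mem_filter.1 hn
    rcases hle.eq_or_lt with heq | hlt
    · exact (hκpos n hn heq.symm).trans (Nat.le_add_left _ _)
    · exact (h.one_le n (Finset.mem_filter.2 ⟨hn, hlt⟩)).trans (Nat.le_add_right _ _)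
  have hmem {n} (hn : n ∈ (K.filter (e ≤ T.depth ·)).filter (fun n => β n + κ n = i)) :
      (n ∈ K ∧ e ≤ T.depth n) ∧ β n + κ n = i := by
    rwa [Finset.mem_filter, Finset.mem_filter] at hn
  refine .of_depth hθ hθ' (fun n hn => (hmem hn).1.2) (fun m hm n hn hme => ?_) ?_
  · obtain ⟨⟨hmK, hme'⟩, rfl⟩ := hmem hm
    obtain ⟨⟨hnK, hne'⟩, heq⟩ := hmem hn
    rcases lt_trichotomy m n with hlt | rfl | hlt
    · exact absurd heq (hsep m hmK n hnK hme' hne' hlt (.inl hme)).ne'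
    · rfl
    · exact absurd heq (hsep n hnK m hmK hne' hme' hlt (.inr hme)).ne
  set D := ((K.filter (e ≤ T.depth ·)).filter (fun n => β n + κ n = i)).filter (e < T.depth ·)
  have hD {n} (hn : n ∈ D) : (n ∈ K ∧ e < T.depth n) ∧ β n + κ n = i := by
    obtain ⟨hn, hlt⟩ := Finset.mem_filter.1 hn
    exact ⟨⟨(hmem hn).1.1, hlt⟩, (hmem hn).2⟩
  rcases D.eq_empty_or_nonempty with hempty | ⟨m, hm⟩
  · rw [hempty]
    exact dominated_empty
  refine (h.dominated (β m)).mono (fun n => by positivity) fun n hn =>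
    Finset.mem_filter.2 ⟨Finset.mem_filter.2 (hD hn).1, ?_⟩
  have heq := (hD hn).2.trans (hD hm).2.symm
  rcases le_total n m with hnm | hnm
  all_goals
    have := h.monotone hnm
    have := hκ hnm
    omega

theorem IsSeparable.dominated {T : LevelTree (schreier α ξ) X} (hK : T.IsSeparable K)
    (hα : IsApproximatingSystem α) (hξ : ξ < ω₁) (hθ : 0 < θ) (hθ' : θ ≤ 1) :
    Dominated (schreier α ξ) θ (fun n => θ ^ T.depth n) K := by
  have hblocking {e} (he : e ≤ K.sup T.depth + 1) :
      ∃ u, IsBlocking (schreier α ξ) θ (fun n => θ ^ (T.depth n - e))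
        (K.filter (e ≤ T.depth ·)) (T.nodes e ∪ T.leavesAt e) u := by
    induction he using Nat.decreasingInduction with
    | self =>
      rw [Finset.filter_false_of_mem fun n hn =>
        (Nat.lt_succ_of_le (Finset.le_sup (f := T.depth) hn)).not_ge]
      exact ⟨fun _ => 0, monotone_const, fun _ => Nat.zero_le _, by simp, fun _ => dominated_empty⟩
    | of_succ e _ ih =>
      obtain ⟨u, hu⟩ := ih
      obtain ⟨β, hβ⟩ := hu.exists_parent hα hξ hθ hθ' (fun n => by positivity) (T.children e)
      exact hK.exists_blocking hθ hθ' hβ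
  obtain ⟨u, hu⟩ := hblocking (Nat.zero_le _)
  refine (hu.dominated 1).mono (fun n => by positivity) fun n hn => ?_
  have hn' : n ∈ K.filter (0 ≤ T.depth ·) := Finset.mem_filter.2 ⟨hn, Nat.zero_le _⟩
  refine Finset.mem_filter.2 ⟨hn', le_antisymm ?_ (hu.one_le n hn')⟩
  exact (hu.le_countLE n).trans ((countLE_le_card _ _).trans T.card_root_le)

theorem isSeparable_everySecond {c : ℕ}
    (hK : ∀ n ∈ K, n ∈ everySecond c (T.leavesAt (T.depth n))) : T.IsSeparable K := by
  intro e β hβ _ _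
  have hS {n} (hn : n ∈ K) (hne : T.depth n = e) : n ∈ everySecond c (T.leavesAt e) :=
    hne ▸ hK n hn
  exact ⟨_, cut_monotone _, fun n => (cut_everySecond_le c _ n).trans (Nat.sub_le _ _),
    fun n hn hne => one_le_cut (hS hn hne), fun m hm n hn _ _ hlt hmn =>
      add_lt_add_of_le_of_lt (hβ hlt.le) (cut_lt_cut hlt (hmn.imp (hS hm) (hS hn)))⟩

/-- No block precedes the leaf `2`, if all numbers are at least `2`, and the unused first leaf of
its level pays for it. -/
theorem isSeparable_everySecond_or_two (hX : ∀ n ∈ X, 2 ≤ n) (hKX : K ⊆ T.leaves)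
    (hK : ∀ n ∈ K, n ∈ everySecond 1 (T.leavesAt (T.depth n)) ∨ n = 2) : T.IsSeparable K := by
  intro e β hβ hβle hβpos
  set Λ := T.leavesAt e
  set S := everySecond 1 Λ
  have hΛ {n} (hn : n ∈ K) (hne : T.depth n = e) : n ∈ Λ :=
    Finset.mem_filter.2 ⟨hKX hn, hne⟩
  have hS {n} (hn : n ∈ K) (hne : T.depth n = e) : n ∈ S ∨ n = 2 := by
    have := hK n hn
    rwa [hne] at this
  have hcard (n) : countLE (Λ ∩ {2}) n ≤ 1 :=
    (countLE_le_card _ n).trans (Finset.card_le_card Finset.inter_subset_right)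
  have hpos {n} (h2 : 2 ∈ Λ) (hn : 2 ≤ n) : 1 ≤ countLE (Λ ∩ {2}) n :=
    (countLE_pos (by simpa using h2)).trans (countLE_monotone _ hn)
  refine ⟨fun n => cut S n + countLE (Λ ∩ {2}) n, (cut_monotone S).add (countLE_monotone _),
    fun n => ?_, fun n hn hne => ?_, fun m hm n hn _ hen hlt hmn => ?_⟩
  · have h1 : cut S n ≤ countLE Λ n - 1 := cut_everySecond_le 1 Λ n
    have h2 := hcard n
    have h3 := countLE_mono_left (Finset.inter_subset_left : Λ ∩ {2} ⊆ Λ) n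
    dsimp only
    omega
  · rcases hS hn hne with hnS | rfl
    · exact (one_le_cut hnS).trans (Nat.le_add_right _ _)
    · exact (hpos (hΛ hn hne) le_rfl).trans (Nat.le_add_left _ _)
  by_cases hmnS : m ∈ S ∨ n ∈ S
  · exact add_lt_add_of_le_of_lt (hβ hlt.le)
      (add_lt_add_of_lt_of_le (cut_lt_cut hlt hmnS) (countLE_monotone _ hlt.le))
  obtain ⟨hmS, hnS⟩ := not_or.1 hmnS
  have h2m : 2 ≤ m := hX m (T.leaves_subset (hKX hm))
  have hn2 : n ≠ 2 := (h2m.trans_lt hlt).ne'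
  have hne : T.depth n ≠ e := fun hne => (hS hn hne).elim hnS hn2
  have hme : T.depth m = e := hmn.resolve_right hne
  obtain rfl : m = 2 := (hS hm hme).resolve_left hmS
  have h1 : β 2 ≤ 0 := (hβle 2).trans_eq <| countLE_eq_zero fun p hp =>
    (hX p (T.nodes_subset e hp)).lt_of_ne' fun hp2 =>
      Finset.disjoint_left.1 (T.disjoint_nodes_leavesAt e) hp (hp2 ▸ hΛ hm hme)
  have h2 : cut S 2 ≤ countLE Λ 2 - 1 := cut_everySecond_le 1 Λ 2
  have h3 : countLE Λ 2 ≤ 1 := countLE_le_one fun p hp =>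
    hX p (T.leaves_subset (Finset.mem_filter.1 hp).1)
  have h4 := hcard 2
  have h5 := hβpos n hn (hen.lt_of_ne' hne)
  have h6 := hpos (hΛ hm hme) hlt.le
  dsimp only
  omega

theorem eval_le {T : LevelTree (schreier α ξ) X} (hα : IsApproximatingSystem α) (hξ : ξ < ω₁)
    (hξ0 : ξ ≠ 0) (hθ : 0 < θ) (hθ' : θ ≤ 1) (hX : ∀ n ∈ X, 2 ≤ n)
    (hT : ∀ n ∈ T.leaves, 0 < T.depth n) (x : ℕ+ →₀ ℝ) :
    T.eval θ x ≤ 3 * tsirelsonNorm (schreier α ξ) θ x := by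
  have mem_leavesAt {n} (hn : n ∈ T.leaves) : n ∈ T.leavesAt (T.depth n) :=
    Finset.mem_filter.2 ⟨hn, rfl⟩
  let isEven (n : ℕ+) : Prop := n ∈ everySecond 0 (T.leavesAt (T.depth n))
  let isOddOrTwo (n : ℕ+) : Prop := n ∈ everySecond 1 (T.leavesAt (T.depth n)) ∨ n = 2
  set L := T.leaves.filter (¬isEven ·)
  set K := L.filter (¬isOddOrTwo ·)
  have hK {n} (hn : n ∈ K) :
      n ∈ T.leaves ∧ countLE (T.leavesAt (T.depth n)) n = 1 ∧ n ≠ 2 := by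
    obtain ⟨hnL, hn1⟩ := Finset.mem_filter.1 hn
    obtain ⟨hnT, hn0⟩ := Finset.mem_filter.1 hnL
    obtain ⟨hn1, hn2⟩ := not_or.1 hn1
    exact ⟨hnT, countLE_eq_one (mem_leavesAt hnT) hn0 hn1, hn2⟩
  have heven : Dominated (schreier α ξ) θ (fun n => θ ^ T.depth n) (T.leaves.filter isEven) :=
    (isSeparable_everySecond fun n hn => (Finset.mem_filter.1 hn).2).dominated hα hξ hθ hθ'
  have hodd : Dominated (schreier α ξ) θ (fun n => θ ^ T.depth n) (L.filter isOddOrTwo) :=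
    (isSeparable_everySecond_or_two hX ((Finset.filter_subset _ _).trans
      (Finset.filter_subset _ _)) fun n hn => (Finset.mem_filter.1 hn).2).dominated hα hξ hθ hθ'
  have hfirst : Dominated (schreier α ξ) θ (fun n => θ ^ T.depth n) K := by
    refine dominated_of_injOn_depth hα hξ hξ0 hθ hθ' (fun n hn => ?_) (fun m hm n hn hmn => ?_)
      fun n hn => hT n (hK hn).1
    · exact Order.succ_le_of_lt ((hX n (T.leaves_subset (hK hn).1)).lt_of_ne' (hK hn).2.2)
    · obtain ⟨hmT, hm1, -⟩ := hK hm
      obtain ⟨hnT, hn1, -⟩ := hK hn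
      rw [hmn] at hm1
      exact countLE_injOn _ (hmn ▸ mem_leavesAt hmT) (mem_leavesAt hnT) (hm1.trans hn1.symm)
  calc T.eval θ x
      = ∑ n ∈ T.leaves.filter isEven, θ ^ T.depth n * |x n| +
          (∑ n ∈ L.filter isOddOrTwo, θ ^ T.depth n * |x n| +
            ∑ n ∈ K, θ ^ T.depth n * |x n|) := by
        rw [Finset.sum_filter_add_sum_filter_not, Finset.sum_filter_add_sum_filter_not, eval]
    _ ≤ 3 * tsirelsonNorm (schreier α ξ) θ x := by linarith [heven x, hodd x, hfirst x]

end LevelTree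

section Join

variable {α : Ordinal.{0} → ℕ+ → Ordinal.{0}} {ξ : Ordinal.{0}} {𝓕 : Set (Finset ℕ+)} {θ : ℝ}
  {Y : Finset ℕ+} {k : ℕ}

theorem mem_schreier_of_countLE_le {E F : Finset ℕ+} (hα : IsApproximatingSystem α) (hξ : ξ < ω₁)
    (hE : E ∈ schreier α ξ) (h : ∀ n ∈ F, countLE F n ≤ countLE E n) : F ∈ schreier α ξ := by
  have hexists (n) (hn : n ∈ F) : ∃ p ∈ E, countLE E p = countLE F n :=
    exists_mem_countLE_eq (countLE_pos hn) ((h n hn).trans (countLE_le_card E n))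
  choose! φ hφE hφ using hexists
  have hφ_le {n} (hn : n ∈ F) : φ n ≤ n :=
    le_of_countLE_le (hφE n hn) ((hφ n hn).trans_le (h n hn))
  refine mem_schreier_of_spread hα hξ hE φ (fun a ha b hb hab => ?_) hφE
    fun a ha _ _ _ => hφ_le ha
  refine (countLE_monotone E).reflect_lt ?_
  rw [hφ a ha, hφ b hb]
  exact countLE_lt hb hab

theorem IsAdmissible.isAllowable {E : Fin k → Finset ℕ+}
    (hE : IsAdmissible 𝓕 fun i => (E i : Set ℕ+)) : IsAllowable 𝓕 fun i => (E i : Set ℕ+) :=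
  ⟨fun _ _ hij => Set.disjoint_left.2 fun _ => hE.disjoint hij, hE.2⟩

theorem injective_of_isLeast {ι : Type*} {E : ι → Set ℕ+}
    (hE : ∀ i j, i ≠ j → Disjoint (E i) (E j)) {m : ι → ℕ+} (hm : ∀ i, IsLeast (E i) (m i)) :
    Function.Injective m := fun i j hij => by
  by_contra hne
  exact Set.disjoint_left.1 (hE i j hne) (hm i).1 (hij ▸ (hm j).1)

theorem IsAllowable.biUnion_mem_schreier (hα : IsApproximatingSystem α) (hξ : ξ < ω₁)
    {E : Fin k → Set ℕ+} (hE : IsAllowable (schreier α ξ) E) {F : Fin k → Finset ℕ+}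
    (hF : ∀ i, ↑(F i) ⊆ E i) (hcard : ∀ i, (F i).card ≤ 1) :
    Finset.univ.biUnion F ∈ schreier α ξ := by
  obtain ⟨hdisj, m, hm, hmem⟩ := hE
  refine mem_schreier_of_countLE_le hα hξ hmem fun n _ => ?_
  have hexists (p) (hp : p ∈ Finset.univ.biUnion F) : ∃ q, ∃ i, p ∈ F i ∧ q = m i := by
    obtain ⟨i, -, hi⟩ := Finset.mem_biUnion.1 hp
    exact ⟨m i, i, hi, rfl⟩
  choose! c hc using hexists
  refine Finset.card_le_card_of_injOn c (fun p hp => ?_) fun p hp q hq hpq => ?_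
  · obtain ⟨hp, hpn⟩ := Finset.mem_filter.1 hp
    obtain ⟨i, hi, hci⟩ := hc p hp
    rw [hci]
    exact Finset.mem_filter.2 ⟨Finset.mem_image_of_mem m (Finset.mem_univ i),
      ((hm i).2 (hF i hi)).trans hpn⟩
  · obtain ⟨i, hi, hci⟩ := hc p (Finset.mem_filter.1 hp).1
    obtain ⟨j, hj, hcj⟩ := hc q (Finset.mem_filter.1 hq).1
    obtain rfl : i = j := injective_of_isLeast hdisj hm (hci.symm.trans (hpq.trans hcj))
    exact Finset.card_le_one.1 (hcard i) p hi q hj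

theorem exists_glue {ι β : Type*} {X : ι → Finset ℕ+} (hX : ∀ i j, i ≠ j → Disjoint (X i) (X j))
    (f : ι → ℕ+ → β) (b : β) :
    ∃ F : ℕ+ → β, (∀ i, ∀ n ∈ X i, F n = f i n) ∧ ∀ n, F n = b ∨ ∃ i, F n = f i n := by
  classical
  refine ⟨fun n => if h : ∃ i, n ∈ X i then f h.choose n else b, fun i n hn => ?_, fun n => ?_⟩
  · have h : ∃ i, n ∈ X i := ⟨i, hn⟩
    have hi : h.choose = i := by
      by_contra hne
      exact Finset.disjoint_left.1 (hX _ _ hne) h.choose_spec hn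
    simp only [dif_pos h, hi]
  · by_cases h : ∃ i, n ∈ X i
    · exact .inr ⟨h.choose, dif_pos h⟩
    · exact .inl (dif_neg h)

theorem isCovered_filter_forall_le {A : Finset ℕ+} (hA : ∀ B ⊆ A, B ∈ 𝓕) (hAY : A ⊆ Y) :
    IsCovered 𝓕 (Y.filter fun v => ∀ n ∈ Y, v ≤ n) id A := by
  refine ⟨fun v => A.filter (v ≤ ·), fun v => hA _ (Finset.filter_subset _ _),
    fun v n hn => (Finset.mem_filter.1 hn).2, fun p hp => ?_⟩
  have hY : Y.Nonempty := ⟨p, hAY hp⟩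
  exact Finset.mem_biUnion.2 ⟨Y.min' hY,
    Finset.mem_filter.2 ⟨Y.min'_mem hY, fun n hn => Y.min'_le n hn⟩,
    Finset.mem_filter.2 ⟨hp, Y.min'_le p (hAY hp)⟩⟩

theorem IsCovered.biUnion (hempty : ∅ ∈ 𝓕) {X J P : Fin k → Finset ℕ+}
    (hX : ∀ i j, i ≠ j → Disjoint (X i) (X j)) (hJ : ∀ i, J i ⊆ X i)
    (h : ∀ i, IsCovered 𝓕 (J i) id (P i)) :
    IsCovered 𝓕 (Finset.univ.biUnion J) id (Finset.univ.biUnion P) := by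
  choose A hA hle hP using h
  obtain ⟨B, hBA, hB⟩ := exists_glue hX A ∅
  refine ⟨B, fun v => ?_, fun v n hn => ?_, Finset.biUnion_subset.2 fun i _ p hp => ?_⟩
  · rcases hB v with h0 | ⟨i, hi⟩
    · exact h0 ▸ hempty
    · exact hi ▸ hA i v
  · rcases hB v with h0 | ⟨i, hi⟩
    · exact absurd (h0 ▸ hn) (Finset.notMem_empty n)
    · exact hle i v n (hi ▸ hn)
  · obtain ⟨v, hv, hpv⟩ := Finset.mem_biUnion.1 (hP i hp)
    exact Finset.mem_biUnion.2 ⟨v, Finset.mem_biUnion.2 ⟨i, Finset.mem_univ i, hv⟩,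
      (hBA i v (hJ i hv)).symm ▸ hpv⟩

namespace LevelTree

/-- The nodes of depth `e` of the tree, inner nodes as well as leaves. -/
def level {X : Finset ℕ+} (T : LevelTree 𝓕 X) (e : ℕ) : Finset ℕ+ := T.nodes e ∪ T.leavesAt e

theorem level_subset {X : Finset ℕ+} (T : LevelTree 𝓕 X) (e : ℕ) : T.level e ⊆ X :=
  Finset.union_subset (T.nodes_subset e) ((Finset.filter_subset _ _).trans T.leaves_subset)

section Children

variable {X : Fin k → Finset ℕ+} {δ : ℕ+ → ℕ}

/-- The leaves of the tree with the trees `T i` as children of the root. -/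
def joinLeaves (T : ∀ i, LevelTree 𝓕 (X i)) : Finset ℕ+ := Finset.univ.biUnion fun i => (T i).leaves

/-- The inner nodes of the tree with the trees `T i` as children of the root, which is recorded by
the minimum of `Y`. -/
def joinNodes (Y : Finset ℕ+) (T : ∀ i, LevelTree 𝓕 (X i)) : ℕ → Finset ℕ+
  | 0 => Y.filter fun v => ∀ n ∈ Y, v ≤ n
  | e + 1 => Finset.univ.biUnion fun i => (T i).nodes e

theorem exists_of_mem_joinLeaves {T : ∀ i, LevelTree 𝓕 (X i)}
    (hδ : ∀ i, ∀ n ∈ X i, δ n = (T i).depth n + 1) {n : ℕ+} (hn : n ∈ joinLeaves T) :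
    ∃ i, n ∈ (T i).leaves ∧ δ n = (T i).depth n + 1 := by
  obtain ⟨i, -, hi⟩ := Finset.mem_biUnion.1 hn
  exact ⟨i, hi, hδ i n ((T i).leaves_subset hi)⟩

theorem joinNodes_subset (hXY : ∀ i, X i ⊆ Y) (T : ∀ i, LevelTree 𝓕 (X i)) :
    ∀ e, joinNodes Y T e ⊆ Y
  | 0 => Finset.filter_subset _ _
  | e + 1 => Finset.biUnion_subset.2 fun i _ => ((T i).nodes_subset e).trans (hXY i)

theorem notMem_joinNodes (hX : ∀ i j, i ≠ j → Disjoint (X i) (X j))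
    {T : ∀ i, LevelTree 𝓕 (X i)} (hδ : ∀ i, ∀ n ∈ X i, δ n = (T i).depth n + 1) :
    ∀ n ∈ joinLeaves T, n ∉ joinNodes Y T (δ n) := fun n hn hmem => by
  obtain ⟨i, hi, hδi⟩ := exists_of_mem_joinLeaves hδ hn
  rw [hδi] at hmem
  obtain ⟨j, -, hj⟩ := Finset.mem_biUnion.1 hmem
  by_cases hij : i = j
  · subst hij
    exact (T i).notMem_nodes n hi hj
  · exact Finset.disjoint_left.1 (hX i j hij) ((T i).leaves_subset hi) ((T j).nodes_subset _ hj)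

theorem joinLevel_subset {T : ∀ i, LevelTree 𝓕 (X i)}
    (hδ : ∀ i, ∀ n ∈ X i, δ n = (T i).depth n + 1) (e : ℕ) :
    joinNodes Y T (e + 1) ∪ (joinLeaves T).filter (δ · = e + 1) ⊆
      Finset.univ.biUnion fun i => (T i).level e := by
  refine Finset.union_subset (Finset.biUnion_mono fun i _ => Finset.subset_union_left)
    fun n hn => ?_
  obtain ⟨hn, hne⟩ := Finset.mem_filter.1 hn
  obtain ⟨i, hi, hδi⟩ := exists_of_mem_joinLeaves hδ hn
  exact Finset.mem_biUnion.2 ⟨i, Finset.mem_univ i, Finset.mem_union_right _ <|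
    Finset.mem_filter.2 ⟨hi, Nat.succ.inj (hδi.symm.trans hne)⟩⟩

theorem sum_joinLeaves (hX : ∀ i j, i ≠ j → Disjoint (X i) (X j))
    {T : ∀ i, LevelTree 𝓕 (X i)} (hδ : ∀ i, ∀ n ∈ X i, δ n = (T i).depth n + 1) (x : ℕ+ →₀ ℝ) :
    ∑ n ∈ joinLeaves T, θ ^ δ n * |x n| = θ * ∑ i, (T i).eval θ x := by
  rw [joinLeaves, Finset.sum_biUnion fun i _ j _ hij => (hX i j hij).mono (T i).leaves_subset
    (T j).leaves_subset, Finset.mul_sum]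
  refine Finset.sum_congr rfl fun i _ => ?_
  rw [eval, Finset.mul_sum]
  refine Finset.sum_congr rfl fun n hn => ?_
  rw [hδ i n ((T i).leaves_subset hn), pow_succ', mul_assoc]

theorem exists_join (hα : IsApproximatingSystem α) (hξ : ξ < ω₁) {E : Fin k → Set ℕ+}
    (hE : IsAllowable (schreier α ξ) E) (hXE : ∀ i, ↑(X i) ⊆ E i) (hXY : ∀ i, X i ⊆ Y)
    (T : ∀ i, LevelTree (schreier α ξ) (X i)) :
    ∃ T' : LevelTree (schreier α ξ) Y, (∀ n ∈ T'.leaves, 0 < T'.depth n) ∧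
      ∀ x, T'.eval θ x = θ * ∑ i, (T i).eval θ x := by
  have hX (i j) (hij : i ≠ j) : Disjoint (X i) (X j) :=
    Finset.disjoint_coe.1 ((hE.1 i j hij).mono (hXE i) (hXE j))
  obtain ⟨δ, hδ, -⟩ := exists_glue hX (fun i n => (T i).depth n + 1) 0
  have hpos : ∀ n ∈ joinLeaves T, 0 < δ n := fun n hn => by
    obtain ⟨i, -, hi⟩ := exists_of_mem_joinLeaves hδ hn
    exact hi ▸ Nat.succ_pos _
  refine ⟨⟨joinLeaves T, δ, joinNodes Y T, Finset.biUnion_subset.2 fun i _ =>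
    (T i).leaves_subset.trans (hXY i), joinNodes_subset hXY T, notMem_joinNodes hX hδ, ?_,
    fun e => ?_⟩, hpos, sum_joinLeaves hX hδ⟩
  · rw [Finset.filter_false_of_mem fun n hn => (hpos n hn).ne', Finset.union_empty]
    exact Finset.card_le_one.2 fun m hm n hn =>
      have hm := Finset.mem_filter.1 hm
      have hn := Finset.mem_filter.1 hn
      le_antisymm (hm.2 n hn.1) (hn.2 m hm.1)
  have hlevel := joinLevel_subset (Y := Y) hδ e
  cases e with
  | zero =>
    have hroots : Finset.univ.biUnion (fun i => (T i).level 0) ∈ schreier α ξ :=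
      hE.biUnion_mem_schreier hα hξ
        (fun i => (Finset.coe_subset.2 ((T i).level_subset 0)).trans (hXE i))
        fun i => (T i).card_root_le
    refine isCovered_filter_forall_le
      (fun B hB => schreier_subset hα hξ hroots (hB.trans hlevel)) (hlevel.trans ?_)
    exact Finset.biUnion_subset.2 fun i _ => ((T i).level_subset 0).trans (hXY i)
  | succ e =>
    obtain ⟨A, hA, hle, hsub⟩ := IsCovered.biUnion (empty_mem_schreier hα hξ) hX
      (fun i => (T i).nodes_subset e) fun i => (T i).children e
    exact ⟨A, hA, hle, hlevel.trans hsub⟩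

end Children

end LevelTree

end Join

theorem ennreal_sum_iSup_pi {ι : Type*} [Fintype ι] {κ : ι → Type*} [∀ i, Nonempty (κ i)]
    (f : ∀ i, κ i → ℝ≥0∞) : ∑ i, ⨆ j, f i j = ⨆ g : ∀ i, κ i, ∑ i, f i (g i) := by
  simp_rw [← (Function.surjective_eval _).iSup_comp (g := f _)]
  refine ENNReal.finsetSum_iSup fun g h => ?_
  have hdir (i) : ∃ j, f i (g i) ≤ f i j ∧ f i (h i) ≤ f i j :=
    (le_total (f i (g i)) (f i (h i))).elim (fun hle => ⟨h i, hle, le_rfl⟩)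
      fun hle => ⟨g i, le_rfl, hle⟩
  choose j hj using hdir
  exact ⟨j, hj⟩

namespace LevelTree

variable {α : Ordinal.{0} → ℕ+ → Ordinal.{0}} {ξ : Ordinal.{0}} {𝓕 : Set (Finset ℕ+)} {θ : ℝ}
  {X Y : Finset ℕ+} {x z : ℕ+ →₀ ℝ} {k : ℕ}

theorem eval_nonneg (T : LevelTree 𝓕 X) (hθ : 0 ≤ θ) (x : ℕ+ →₀ ℝ) : 0 ≤ T.eval θ x :=
  Finset.sum_nonneg fun _ _ => mul_nonneg (pow_nonneg hθ _) (abs_nonneg _)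

theorem eval_congr (T : LevelTree 𝓕 X) (h : ∀ n ∈ X, x n = z n) : T.eval θ x = T.eval θ z :=
  Finset.sum_congr rfl fun n hn => by rw [h n (T.leaves_subset hn)]

/-- The tree with at most one node, a leaf. -/
def ofLeaf (h𝓕 : ∅ ∈ 𝓕) {L : Finset ℕ+} (hL : L.card ≤ 1) (hLX : L ⊆ X) : LevelTree 𝓕 X where
  leaves := L
  depth _ := 0
  nodes _ := ∅
  leaves_subset := hLX
  nodes_subset _ := Finset.empty_subset _
  notMem_nodes _ _ := Finset.notMem_empty _
  card_root_le := by simpa using hL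
  children _ := ⟨fun _ => ∅, fun _ => h𝓕, by simp, by simp⟩

theorem nonempty_of_empty_mem (h𝓕 : ∅ ∈ 𝓕) (X : Finset ℕ+) : Nonempty (LevelTree 𝓕 X) :=
  ⟨ofLeaf h𝓕 (Finset.card_empty.trans_le zero_le_one) (Finset.empty_subset X)⟩

theorem enorm_apply_le_iSup_eval (h𝓕 : ∅ ∈ 𝓕) (hx : x.support ⊆ X) (n : ℕ+) :
    ‖x n‖ₑ ≤ ⨆ T : LevelTree 𝓕 X, ENNReal.ofReal (T.eval θ x) := by
  by_cases hn : x n = 0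
  · simp [hn]
  have hnX : {n} ⊆ X := Finset.singleton_subset_iff.2 (hx (Finsupp.mem_support_iff.2 hn))
  refine le_iSup_of_le (ofLeaf h𝓕 (Finset.card_singleton n).le hnX) ?_
  simp [eval, ofLeaf, ← Real.norm_eq_abs, ofReal_norm]

theorem mul_sum_iSup_eval_le (hα : IsApproximatingSystem α) (hξ : ξ < ω₁) (hθ : 0 ≤ θ)
    {E : Fin k → Set ℕ+} (hE : IsAllowable (schreier α ξ) E) {X : Fin k → Finset ℕ+}
    (hXE : ∀ i, ↑(X i) ⊆ E i) (hXY : ∀ i, X i ⊆ Y) {x : Fin k → ℕ+ →₀ ℝ}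
    (hxz : ∀ i, ∀ n ∈ X i, x i n = z n) :
    ENNReal.ofReal θ * ∑ i, ⨆ T : LevelTree (schreier α ξ) (X i), ENNReal.ofReal (T.eval θ (x i)) ≤
      ⨆ (T : LevelTree (schreier α ξ) Y) (_ : ∀ n ∈ T.leaves, 0 < T.depth n),
        ENNReal.ofReal (T.eval θ z) := by
  have hne (i) := nonempty_of_empty_mem (empty_mem_schreier hα hξ) (X i)
  rw [ennreal_sum_iSup_pi, ENNReal.mul_iSup]
  refine iSup_le fun T => ?_
  obtain ⟨T', hT', heval⟩ := exists_join (θ := θ) hα hξ hE hXE hXY T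
  refine le_iSup₂_of_le T' hT' ?_
  rw [heval, ENNReal.ofReal_mul hθ, ENNReal.ofReal_sum_of_nonneg fun i _ => eval_nonneg _ hθ _]
  exact le_of_eq (by simp_rw [eval_congr _ (hxz _)])

theorem tsirelsonIter_le_iSup_eval (hα : IsApproximatingSystem α) (hξ : ξ < ω₁) (hθ : 0 ≤ θ)
    (hx : x.support ⊆ X) (s : ℕ) :
    tsirelsonIter (schreier α ξ) θ s x ≤
      ⨆ T : LevelTree (schreier α ξ) X, ENNReal.ofReal (T.eval θ x) := by
  have hsup : ⨆ n, ‖x n‖ₑ ≤ ⨆ T : LevelTree (schreier α ξ) X, ENNReal.ofReal (T.eval θ x) :=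
    iSup_le (enorm_apply_le_iSup_eval (empty_mem_schreier hα hξ) hx)
  induction s generalizing x X with
  | zero => exact hsup
  | succ s ih =>
    refine max_le hsup ?_
    simp only [ENNReal.mul_iSup]
    refine iSup_le fun k => iSup₂_le fun E hE => ?_
    have hproj (i) : (proj (E i) x).support ⊆ X ∩ E i := fun n hn => by
      rw [proj, Finsupp.support_filter, Finset.mem_filter] at hn
      exact Finset.mem_inter.2 ⟨hx hn.1, hn.2⟩
    calc ENNReal.ofReal θ * ∑ i, tsirelsonIter (schreier α ξ) θ s (proj (E i) x)
        ≤ ENNReal.ofReal θ * ∑ i, ⨆ T : LevelTree (schreier α ξ) (X ∩ E i),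
            ENNReal.ofReal (T.eval θ (proj (E i) x)) := by
          gcongr with i
          exact ih (hproj i)
            (iSup_le (enorm_apply_le_iSup_eval (empty_mem_schreier hα hξ) (hproj i)))
      _ ≤ ⨆ (T : LevelTree (schreier α ξ) X) (_ : ∀ n ∈ T.leaves, 0 < T.depth n),
            ENNReal.ofReal (T.eval θ x) :=
          mul_sum_iSup_eval_le hα hξ hθ hE.isAllowable
            (fun i => Finset.coe_subset.2 Finset.inter_subset_right)
            (fun i => Finset.inter_subset_left) fun i n hn =>
              Finsupp.filter_apply_pos (· ∈ E i) x (Finset.mem_inter.1 hn).2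
      _ ≤ ⨆ T : LevelTree (schreier α ξ) X, ENNReal.ofReal (T.eval θ x) :=
          iSup_mono fun T => iSup_le fun _ => le_rfl

end LevelTree

section FinitelySupported

variable {α : Ordinal.{0} → ℕ+ → Ordinal.{0}} {ξ : Ordinal.{0}} {θ : ℝ} {k : ℕ}

theorem IsAllowable.subsingleton_or_two_le {E : Fin k → Set ℕ+}
    (hE : IsAllowable (schreier α ξ) E) :
    Subsingleton (Fin k) ∨ ξ ≠ 0 ∧ ∀ i, ∀ n ∈ E i, 2 ≤ n := by
  obtain ⟨hdisj, m, hm, hmem⟩ := hE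
  have hinj := injective_of_isLeast hdisj hm
  have hm_mem (i) : m i ∈ Finset.univ.image m := Finset.mem_image_of_mem m (Finset.mem_univ i)
  rcases subsingleton_or_nontrivial (Fin k) with hk | hk
  · exact .inl hk
  refine .inr ⟨?_, fun i n hn => ?_⟩
  · rintro rfl
    obtain ⟨i, j, hij⟩ := exists_pair_ne (Fin k)
    exact hij (hinj (Finset.card_le_one.1 (schreier_zero_iff.1 hmem) _ (hm_mem i) _ (hm_mem j)))
  · have hmi : m i ≠ 1 := fun h1 => by
      obtain ⟨j, hj⟩ := exists_ne i
      have hmj := eq_one_of_one_mem_schreier hmem (h1 ▸ hm_mem i) _ (hm_mem j)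
      exact hj (hinj (hmj.trans h1.symm))
    exact (Order.succ_le_of_lt (one_le.lt_of_ne' hmi)).trans ((hm i).2 hn)

theorem IsAllowable.sum_apply_of_mem {𝓕 : Set (Finset ℕ+)} {E : Fin k → Set ℕ+}
    (hE : IsAllowable 𝓕 E) {x : Fin k → ℕ+ →₀ ℝ} (hx : ∀ i, ↑(x i).support ⊆ E i) {i : Fin k}
    {n : ℕ+} (hn : n ∈ E i) : (∑ j, x j) n = x i n := by
  rw [Finsupp.finsetSum_apply]
  refine Finset.sum_eq_single i (fun j _ hji => ?_) fun h => absurd (Finset.mem_univ i) h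
  exact Finsupp.notMem_support_iff.1 fun hj => Set.disjoint_left.1 (hE.1 j i hji) (hx j hj) hn

theorem mul_sum_tsirelsonNorm_le_of_subsingleton [Subsingleton (Fin k)] {𝓕 : Set (Finset ℕ+)}
    (hθ : θ ≤ 3) (x : Fin k → ℕ+ →₀ ℝ) :
    θ * ∑ i, tsirelsonNorm 𝓕 θ (x i) ≤ 3 * tsirelsonNorm 𝓕 θ (∑ i, x i) := by
  rcases isEmpty_or_nonempty (Fin k) with hk | ⟨⟨i⟩⟩
  · simp [tsirelsonNorm_zero]
  · rw [Fintype.sum_subsingleton _ i, Fintype.sum_subsingleton _ i]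
    exact mul_le_mul_of_nonneg_right hθ (tsirelsonNorm_nonneg _)

theorem mul_sum_tsirelsonNorm_le (hα : IsApproximatingSystem α) (hξ : ξ < ω₁) (hθ : 0 < θ)
    (hθ' : θ ≤ 1) {E : Fin k → Set ℕ+} (hE : IsAllowable (schreier α ξ) E)
    {x : Fin k → ℕ+ →₀ ℝ} (hx : ∀ i, ↑(x i).support ⊆ E i) :
    θ * ∑ i, tsirelsonNorm (schreier α ξ) θ (x i) ≤
      3 * tsirelsonNorm (schreier α ξ) θ (∑ i, x i) := by
  rcases hE.subsingleton_or_two_le with hk | ⟨hξ0, hE2⟩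
  · exact mul_sum_tsirelsonNorm_le_of_subsingleton (hθ'.trans (by norm_num)) x
  set Y := Finset.univ.biUnion fun i => (x i).support
  have hY : ∀ n ∈ Y, 2 ≤ n := fun n hn => by
    obtain ⟨i, -, hi⟩ := Finset.mem_biUnion.1 hn
    exact hE2 i n (hx i hi)
  refine (ENNReal.ofReal_le_ofReal_iff (mul_nonneg zero_le_three (tsirelsonNorm_nonneg _))).1 ?_
  calc ENNReal.ofReal (θ * ∑ i, tsirelsonNorm (schreier α ξ) θ (x i))
      = ENNReal.ofReal θ * ∑ i, ENNReal.ofReal (tsirelsonNorm (schreier α ξ) θ (x i)) := by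
        rw [ENNReal.ofReal_mul hθ.le,
          ENNReal.ofReal_sum_of_nonneg fun i _ => tsirelsonNorm_nonneg (x i)]
    _ ≤ ENNReal.ofReal θ * ∑ i, ⨆ T : LevelTree (schreier α ξ) (x i).support,
          ENNReal.ofReal (T.eval θ (x i)) := by
        gcongr with i
        exact ENNReal.ofReal_toReal_le.trans
          (iSup_le (LevelTree.tsirelsonIter_le_iSup_eval hα hξ hθ.le subset_rfl))
    _ ≤ ⨆ (T : LevelTree (schreier α ξ) Y) (_ : ∀ n ∈ T.leaves, 0 < T.depth n),
          ENNReal.ofReal (T.eval θ (∑ i, x i)) :=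
        LevelTree.mul_sum_iSup_eval_le hα hξ hθ.le hE hx
          (fun i => Finset.subset_biUnion_of_mem (fun i => (x i).support) (Finset.mem_univ i))
          fun i n hn => (hE.sum_apply_of_mem hx (hx i hn)).symm
    _ ≤ ENNReal.ofReal (3 * tsirelsonNorm (schreier α ξ) θ (∑ i, x i)) :=
        iSup₂_le fun T hT => ENNReal.ofReal_le_ofReal
          (T.eval_le hα hξ hξ0 hθ hθ' hY hT (∑ i, x i))

end FinitelySupported

section Projection

variable {𝓕 : Set (Finset ℕ+)} {θ : ℝ}

theorem proj_comm (E F : Finset ℕ+) (x : ℕ+ →₀ ℝ) : proj E (proj F x) = proj F (proj E x) := by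
  ext n
  by_cases hE : n ∈ E <;> by_cases hF : n ∈ F <;> simp [proj, hE, hF]

theorem tsirelsonIter_proj_le (E : Finset ℕ+) (s : ℕ) (x : ℕ+ →₀ ℝ) :
    tsirelsonIter 𝓕 θ s (proj E x) ≤ tsirelsonIter 𝓕 θ s x := by
  have hsup (x : ℕ+ →₀ ℝ) : ⨆ n, ‖proj E x n‖ₑ ≤ ⨆ n, ‖x n‖ₑ :=
    iSup_mono fun n => by by_cases h : n ∈ E <;> simp [proj, h]
  induction s generalizing x with
  | zero => exact hsup x
  | succ s ih =>
    refine max_le_max (hsup x) (mul_le_mul_right ?_ _)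
    refine iSup_mono fun k => iSup₂_mono fun F _ => Finset.sum_le_sum fun i _ => ?_
    rw [proj_comm]
    exact ih _

theorem tsirelsonNorm_proj_le (hθ : θ ≤ 1) (E : Finset ℕ+) (x : ℕ+ →₀ ℝ) :
    tsirelsonNorm 𝓕 θ (proj E x) ≤ tsirelsonNorm 𝓕 θ x :=
  ENNReal.toReal_mono (iSup_tsirelsonIter_ne_top hθ x)
    (iSup_mono fun s => tsirelsonIter_proj_le E s x)

end Projection

namespace TsirelsonSpace

variable {𝓕 : Set (Finset ℕ+)} {θ : Set.Ioo (0 : ℝ) 1}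

/-- The inclusion of `c₀₀` into the Tsirelson space. -/
noncomputable def ofFinsupp : (ℕ+ →₀ ℝ) →ₗ[ℝ] TsirelsonSpace 𝓕 θ :=
  ((UniformSpace.Completion.toComplL : TsirelsonC00 𝓕 θ →L[ℝ] TsirelsonSpace 𝓕 θ) :
    TsirelsonC00 𝓕 θ →ₗ[ℝ] TsirelsonSpace 𝓕 θ)

theorem norm_ofFinsupp (x : ℕ+ →₀ ℝ) :
    ‖(ofFinsupp x : TsirelsonSpace 𝓕 θ)‖ = tsirelsonNorm 𝓕 θ x :=
  UniformSpace.Completion.norm_coe (E := TsirelsonC00 𝓕 θ) x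

theorem denseRange_ofFinsupp : DenseRange (ofFinsupp : (ℕ+ →₀ ℝ) → TsirelsonSpace 𝓕 θ) :=
  UniformSpace.Completion.denseRange_coe (α := TsirelsonC00 𝓕 θ)

theorem coord_ofFinsupp (n : ℕ+) (x : ℕ+ →₀ ℝ) :
    coord n (ofFinsupp x : TsirelsonSpace 𝓕 θ) = x n :=
  ContinuousLinearMap.fromCompletion_apply_coe (TsirelsonC00.coord n) x

theorem supp_smul_subset (a : ℝ) (y : TsirelsonSpace 𝓕 θ) : supp (a • y) ⊆ supp y :=
  fun n hn h => hn (by rw [map_smul, h, smul_zero])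

/-- The first `N` coordinates of a vector of the Tsirelson space. -/
noncomputable def truncate (N : ℕ+) : TsirelsonSpace 𝓕 θ →ₗ[ℝ] ℕ+ →₀ ℝ :=
  ∑ n ∈ Finset.Iic N, Finsupp.lsingle n ∘ₗ (coord (𝓕 := 𝓕) (θ := θ) n).toLinearMap

theorem truncate_apply (N n : ℕ+) (y : TsirelsonSpace 𝓕 θ) :
    truncate N y n = if n ≤ N then coord n y else 0 := by
  simp [truncate, Finsupp.finsetSum_apply, Finsupp.single_apply]

theorem truncate_ofFinsupp (N : ℕ+) (x : ℕ+ →₀ ℝ) :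
    truncate N (ofFinsupp x : TsirelsonSpace 𝓕 θ) = proj (Finset.Iic N) x := by
  ext n
  rw [truncate_apply, coord_ofFinsupp]
  by_cases h : n ≤ N <;> simp [proj, h]

theorem support_truncate_subset (N : ℕ+) (y : TsirelsonSpace 𝓕 θ) :
    ↑(truncate N y).support ⊆ supp y := fun n hn hn0 => by
  rw [Finset.mem_coe, Finsupp.mem_support_iff, truncate_apply, hn0, ite_self] at hn
  exact hn rfl

theorem continuous_ofFinsupp_truncate (N : ℕ+) :
    Continuous fun y : TsirelsonSpace 𝓕 θ => (ofFinsupp (truncate N y) : TsirelsonSpace 𝓕 θ) := by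
  have h (y : TsirelsonSpace 𝓕 θ) : (ofFinsupp (truncate N y) : TsirelsonSpace 𝓕 θ) =
      ∑ n ∈ Finset.Iic N, coord n y • ofFinsupp (Finsupp.single n 1) := by
    simp [truncate, ← map_smul]
  simp only [h]
  fun_prop

theorem norm_truncate_le (N : ℕ+) (y : TsirelsonSpace 𝓕 θ) :
    ‖(ofFinsupp (truncate N y) : TsirelsonSpace 𝓕 θ)‖ ≤ ‖y‖ := by
  induction y using denseRange_ofFinsupp.induction_on with
  | hp => exact isClosed_le (continuous_ofFinsupp_truncate N).norm continuous_norm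
  | ih x =>
    rw [truncate_ofFinsupp, norm_ofFinsupp, norm_ofFinsupp]
    exact tsirelsonNorm_proj_le θ.2.2.le _ x

theorem truncate_ofFinsupp_eventually_eq (x : ℕ+ →₀ ℝ) :
    ∀ᶠ N in Filter.atTop, truncate N (ofFinsupp x : TsirelsonSpace 𝓕 θ) = x := by
  filter_upwards [Filter.eventually_ge_atTop (x.support.sup id)] with N hN
  rw [truncate_ofFinsupp, proj, Finsupp.filter_eq_self_iff]
  exact fun n hn => Finset.mem_Iic.2
    ((Finset.le_sup (f := id) (Finsupp.mem_support_iff.2 hn)).trans hN)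

theorem tendsto_truncate (y : TsirelsonSpace 𝓕 θ) :
    Filter.Tendsto (fun N => (ofFinsupp (truncate N y) : TsirelsonSpace 𝓕 θ)) Filter.atTop
      (nhds y) := by
  refine Metric.tendsto_nhds.2 fun ε hε => ?_
  obtain ⟨x, hx⟩ := denseRange_ofFinsupp.exists_dist_lt y (half_pos hε)
  filter_upwards [truncate_ofFinsupp_eventually_eq (𝓕 := 𝓕) (θ := θ) x] with N hN
  have htruncate : truncate N (y - ofFinsupp x) = truncate N y - x := by rw [map_sub, hN]
  have hclose := norm_truncate_le N (y - ofFinsupp x)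
  rw [htruncate, map_sub, ← dist_eq_norm, ← dist_eq_norm] at hclose
  calc dist (ofFinsupp (truncate N y)) y
      ≤ dist (ofFinsupp (truncate N y)) (ofFinsupp x) + dist y (ofFinsupp x) :=
        dist_triangle_right ..
    _ < ε := by linarith

theorem mul_sum_norm_le {α : Ordinal.{0} → ℕ+ → Ordinal.{0}} (hα : IsApproximatingSystem α)
    {ξ : Ordinal.{0}} (hξ : ξ < ω₁) {k : ℕ} {E : Fin k → Set ℕ+}
    (hE : IsAllowable (schreier α ξ) E) {y : Fin k → TsirelsonSpace (schreier α ξ) θ}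
    (hy : ∀ j, supp (y j) ⊆ E j) : θ * ∑ j, ‖y j‖ ≤ 3 * ‖∑ j, y j‖ := by
  refine le_of_tendsto_of_tendsto'
    ((tendsto_finsetSum _ fun j _ => (tendsto_truncate (y j)).norm).const_mul (θ : ℝ))
    ((tendsto_truncate (∑ j, y j)).norm.const_mul 3) fun N => ?_
  rw [map_sum]
  simp only [norm_ofFinsupp]
  exact mul_sum_tsirelsonNorm_le hα hξ θ.2.1 θ.2.2.le hE fun j =>
    (support_truncate_subset N (y j)).trans (hy j)

end TsirelsonSpace

theorem corollary4p10
    (α : Ordinal.{0} → ℕ+ → Ordinal.{0}) (hα : IsApproximatingSystem α)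
    (ξ : Ordinal.{0}) (hξ : ξ < ω₁) (θ : Set.Ioo (0 : ℝ) 1)
    (k : ℕ) (y : Fin k → TsirelsonSpace (schreier α ξ) θ)
    (hy : ∀ j, ‖y j‖ = 1)
    (hsupp : IsAllowable (schreier α ξ) fun j => TsirelsonSpace.supp (y j))
    (a : Fin k → ℝ) :
    (θ : ℝ) / 3 * ∑ j, |a j| ≤ ‖∑ j, a j • y j‖ ∧ ‖∑ j, a j • y j‖ ≤ ∑ j, |a j| := by
  have hnorm (j) : ‖a j • y j‖ = |a j| := by rw [norm_smul, hy, mul_one, Real.norm_eq_abs]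
  have hlower := TsirelsonSpace.mul_sum_norm_le hα hξ hsupp fun j =>
    TsirelsonSpace.supp_smul_subset (a j) (y j)
  have hupper := norm_sum_le Finset.univ fun j => a j • y j
  simp only [hnorm] at hlower hupper
  exact ⟨by linarith, hupper⟩
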